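/- Let $k$ be a commutative ring. Let $Lie$ be the $k$-linear symmetric operad generated by one antisymmetric binary operation $\mu=[\,,]$ subject to the Jacobi relation $[x_1,[x_2,x_3]]=[[x_1,x_2],x_3]-[[x_1,x_3],x_2]$; for a finite set $S$ write $Lie(S)$ for its component with inputs labelled by $S$, so that $Lie(\emptyset)=0$. Let $\Gamma_{sh}^{Lie}$ be the $k$-linear category with objects the pointed sets $[n]=\{0,1,\dots,n\}$ (base point $0$), $n\ge 0$, and morphisms $$\Gamma_{sh}^{Lie}([n],[m])=\bigoplus_{\alpha} Lie(\alpha^{-1}(0))\otimes\cdots\otimes Lie(\alpha^{-1}(m)),$$ where $\alpha$ runs over the pointed surjections $[n]\to[m]$ that are shuffling, i.e. $\min\alpha^{-1}(i)<\min\alpha^{-1}(j)$ whenever $i<j$. Composition is given by composition of the maps $\alpha$ and by operadic composition in $Lie$. For $0\le i<j\le n+1$ let $d_{i,j}\in\Gamma_{sh}^{Lie}([n+1],[n])$ be the generator attached to the unique shuffling surjection sending both $i$ and $j$ to $i$, with the bracket $\mu=[i,j]$ on the fibre $\{i,j\}$ and the operadic unit on all other fibres. For a $k$-linear functor $T$ from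 $\Gamma_{sh}^{Lie}$ to $k$-modules, the Leibniz complex $C^{Leib}_*(T)$ has $C_n^{Leib}(T)=T([n])$ for $n\ge 0$ and differential $T\big(\sum_{0\le i<j\le n}(-1)^j d_{i,j}\big)\colon T([n])\to T([n-1])$; its homology is the Leibniz homology $H^{Leib}_*(T)$. **Proposition.** For all $n\ge 0$ and $i>0$, the representable functor $P_n=\Gamma_{sh}^{Lie}([n],-)$ satisfies $$H_i^{Leib}(P_n)=0.$$ -/

import Mathlib

namespace LieSh

noncomputable section

/-! ### The operad `Lie`

Binary planar trees with leaves labelled by `A` are the elements of `FreeMagma A`: a leaf is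
`FreeMagma.of a` and `s * t` is the tree whose root is a bracket vertex with left subtree `s` and
right subtree `t`. -/

/-- The labels of the leaves of a tree, read from left to right. -/
def leaves {A : Type*} : FreeMagma A → List A
  | FreeMagma.of a => [a]
  | FreeMagma.mul s t => leaves s ++ leaves t

/-- `IsOn t S`: the leaves of `t` are labelled bijectively by the elements of `S`. -/
structure IsOn {A : Type*} (t : FreeMagma A) (S : Set A) : Prop where
  nodup : (leaves t).Nodup
  mem_iff : ∀ a, a ∈ leaves t ↔ a ∈ S

/-- Trees whose leaves are labelled bijectively by `S`: together with their linear combinations,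
the arity `S` component of the free operad on one binary operation without symmetry. -/
abbrev TreeOn {A : Type*} (S : Set A) : Type _ := {t : FreeMagma A // IsOn t S}

/-- The second tree is obtained from the first by exchanging the two subtrees of one vertex. -/
inductive Anti {A : Type*} : FreeMagma A → FreeMagma A → Prop
  | swap (s t : FreeMagma A) : Anti (s * t) (t * s)
  | left {s s' : FreeMagma A} (t : FreeMagma A) : Anti s s' → Anti (s * t) (s' * t)
  | right (t : FreeMagma A) {s s' : FreeMagma A} : Anti s s' → Anti (t * s) (t * s')

/-- The three trees differ only at one place, where they are respectively
`[r,[s,t]]`, `[[r,s],t]` and `[[r,t],s]` for some trees `r`, `s`, `t`. -/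
inductive Jac {A : Type*} : FreeMagma A → FreeMagma A → FreeMagma A → Prop
  | node (r s t : FreeMagma A) : Jac (r * (s * t)) ((r * s) * t) ((r * t) * s)
  | left {x y z : FreeMagma A} (t : FreeMagma A) : Jac x y z → Jac (x * t) (y * t) (z * t)
  | right (t : FreeMagma A) {x y z : FreeMagma A} : Jac x y z → Jac (t * x) (t * y) (t * z)

/-- The antisymmetry relations `s + s' = 0` and the Jacobi relations `x - y + z = 0`
in the linear combinations of trees on `S`. -/
def lieRel (k : Type*) [CommRing k] {A : Type*} (S : Set A) : Submodule k (TreeOn S →₀ k) :=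
  Submodule.span k
    ({v | ∃ s t : TreeOn S, Anti s.1 t.1 ∧ v = Finsupp.single s 1 + Finsupp.single t 1} ∪
     {v | ∃ x y z : TreeOn S, Jac x.1 y.1 z.1 ∧
        v = Finsupp.single x 1 - Finsupp.single y 1 + Finsupp.single z 1})

/-- `LieOp k S` is `Lie(S)`, the component of the operad `Lie` at the finite set `S`: the operad
generated by one antisymmetric binary operation subject to the Jacobi relation. (It is zero if
`S` is empty or infinite, as there are no trees on such an `S`.) -/
def LieOp (k : Type*) [CommRing k] {A : Type*} (S : Set A) : Type _ :=
  (TreeOn S →₀ k) ⧸ lieRel k S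

instance (k : Type*) [CommRing k] {A : Type*} (S : Set A) : AddCommGroup (LieOp k S) :=
  inferInstanceAs (AddCommGroup ((TreeOn S →₀ k) ⧸ lieRel k S))

instance (k : Type*) [CommRing k] {A : Type*} (S : Set A) : Module k (LieOp k S) :=
  inferInstanceAs (Module k ((TreeOn S →₀ k) ⧸ lieRel k S))

namespace LieOp

section

variable {k : Type*} [CommRing k] {A B : Type*}

/-- The quotient map from linear combinations of trees on `S` to `Lie(S)`. -/
def proj (S : Set A) : (TreeOn S →₀ k) →ₗ[k] LieOp k S := (lieRel k S).mkQ

theorem proj_eq_zero {S : Set A} {v : TreeOn S →₀ k} (h : v ∈ lieRel k S) : proj S v = 0 :=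
  (Submodule.Quotient.mk_eq_zero _).2 h

theorem proj_surjective (S : Set A) : Function.Surjective (proj (k := k) S) :=
  (lieRel k S).mkQ_surjective

/-- The element of `Lie(S)` represented by a tree on `S`. -/
def mk {S : Set A} (t : FreeMagma A) (h : IsOn t S) : LieOp k S :=
  proj S (Finsupp.single ⟨t, h⟩ 1)

theorem mk_anti {S : Set A} {s t : FreeMagma A} (hs : IsOn s S) (ht : IsOn t S)
    (h : Anti s t) : (mk s hs + mk t ht : LieOp k S) = 0 := by
  unfold mk
  rw [← map_add]
  exact proj_eq_zero (Submodule.subset_span (Or.inl ⟨⟨s, hs⟩, ⟨t, ht⟩, h, rfl⟩))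

theorem mk_jac {S : Set A} {x y z : FreeMagma A} (hx : IsOn x S) (hy : IsOn y S)
    (hz : IsOn z S) (h : Jac x y z) : (mk x hx - mk y hy + mk z hz : LieOp k S) = 0 := by
  unfold mk
  rw [← map_sub, ← map_add]
  exact proj_eq_zero
    (Submodule.subset_span (Or.inr ⟨⟨x, hx⟩, ⟨y, hy⟩, ⟨z, hz⟩, h, rfl⟩))

/-- A map on trees that respects the relations extends linearly to `Lie(S)`. -/
def lift {S : Set A} {M : Type*} [AddCommGroup M] [Module k M]
    (φ : (t : FreeMagma A) → IsOn t S → M)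
    (hA : ∀ s t hs ht, Anti s t → φ s hs + φ t ht = 0)
    (hJ : ∀ x y z hx hy hz, Jac x y z → φ x hx - φ y hy + φ z hz = 0) : LieOp k S →ₗ[k] M :=
  (lieRel k S).liftQ (Finsupp.linearCombination k fun t : TreeOn S => φ t.1 t.2) (by
    refine Submodule.span_le.2 ?_
    rintro v (⟨s, t, h, rfl⟩ | ⟨x, y, z, h, rfl⟩)
    · simpa using hA _ _ s.2 t.2 h
    · simpa using hJ _ _ _ x.2 y.2 z.2 h)

@[simp] theorem lift_mk {S : Set A} {M : Type*} [AddCommGroup M] [Module k M]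
    (φ : (t : FreeMagma A) → IsOn t S → M) (hA) (hJ) (t : FreeMagma A) (h : IsOn t S) :
    lift (k := k) φ hA hJ (mk t h) = φ t h := by
  have : lift (k := k) φ hA hJ (mk t h) =
    Finsupp.linearCombination k (fun t : TreeOn S => φ t.1 t.2) (Finsupp.single ⟨t, h⟩ 1) :=
    Submodule.liftQ_apply _ _ _
  simpa using this

theorem induct {S : Set A} {P : LieOp k S → Prop} (h0 : P 0)
    (hadd : ∀ x y, P x → P y → P (x + y)) (hsmul : ∀ (c : k) x, P x → P (c • x))
    (hmk : ∀ t h, P (mk t h)) (x : LieOp k S) : P x := by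
  obtain ⟨v, rfl⟩ := proj_surjective S x
  induction v using Finsupp.induction_linear with
  | zero => simpa using h0
  | add f g hf hg => rw [map_add]; exact hadd _ _ hf hg
  | single t c =>
    have : Finsupp.single t c = c • (Finsupp.single t 1 : TreeOn S →₀ k) := by simp
    rw [this, map_smul]
    exact hsmul _ _ (hmk t.1 t.2)

theorem hom_ext {S : Set A} {M : Type*} [AddCommGroup M] [Module k M]
    {f g : LieOp k S →ₗ[k] M} (h : ∀ t ht, f (mk t ht) = g (mk t ht)) : f = g := by
  ext x
  induction x using induct with
  | h0 => simp
  | hadd x y hx hy => simp [hx, hy]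
  | hsmul c x hx => simp [hx]
  | hmk t ht => exact h t ht

end

end LieOp

section

variable {k : Type*} [CommRing k] {A B C : Type*}

@[simp] theorem leaves_of (a : A) : leaves (FreeMagma.of a) = [a] := rfl

@[simp] theorem leaves_mul (s t : FreeMagma A) : leaves (s * t) = leaves s ++ leaves t := rfl

theorem isOn_of_iff {a : A} {S : Set A} : IsOn (FreeMagma.of a) S ↔ {a} = S := by
  constructor
  · rintro ⟨-, h⟩
    ext x
    simpa using h x
  · rintro rfl
    exact ⟨by simp, by simp⟩

theorem isOn_mul {s t : FreeMagma A} {S T U : Set A} (hs : IsOn s S) (ht : IsOn t T)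
    (hd : Disjoint S T) (hU : S ∪ T = U) : IsOn (s * t) U := by
  subst hU
  refine ⟨?_, ?_⟩
  · rw [leaves_mul, List.nodup_append']
    refine ⟨hs.nodup, ht.nodup, ?_⟩
    intro a h1 h2
    exact Set.disjoint_left.1 hd ((hs.mem_iff a).1 h1) ((ht.mem_iff a).1 h2)
  · intro a
    simp [hs.mem_iff, ht.mem_iff]

/-- The set of labels of a tree. -/
def leafSet (t : FreeMagma A) : Set A := {a | a ∈ leaves t}

theorem IsOn.eq {t : FreeMagma A} {S : Set A} (h : IsOn t S) : leafSet t = S := by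
  ext a
  exact h.mem_iff a

theorem IsOn.left {s t : FreeMagma A} {U : Set A} (h : IsOn (s * t) U) : IsOn s (leafSet s) :=
  ⟨(List.nodup_append'.1 h.nodup).1, fun _ => Iff.rfl⟩

theorem IsOn.right {s t : FreeMagma A} {U : Set A} (h : IsOn (s * t) U) : IsOn t (leafSet t) :=
  ⟨(List.nodup_append'.1 h.nodup).2.1, fun _ => Iff.rfl⟩

theorem IsOn.disj {s t : FreeMagma A} {U : Set A} (h : IsOn (s * t) U) :
    Disjoint (leafSet s) (leafSet t) :=
  Set.disjoint_left.2 fun _ h1 h2 => (List.nodup_append'.1 h.nodup).2.2 h1 h2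

theorem IsOn.union {s t : FreeMagma A} {U : Set A} (h : IsOn (s * t) U) :
    leafSet s ∪ leafSet t = U := by
  rw [← h.eq]
  ext a
  simp [leafSet]

theorem Anti.perm {s t : FreeMagma A} (h : Anti s t) : (leaves s).Perm (leaves t) := by
  induction h with
  | swap s t => exact List.perm_append_comm
  | left t _ ih => exact ih.append_right _
  | right t _ ih => exact ih.append_left _

theorem Jac.perm {x y z : FreeMagma A} (h : Jac x y z) :
    (leaves x).Perm (leaves y) ∧ (leaves x).Perm (leaves z) := by
  induction h with
  | node r s t =>
    simp only [leaves_mul, List.append_assoc]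
    exact ⟨List.Perm.refl _, List.perm_append_comm.append_left _⟩
  | left t _ ih => exact ⟨ih.1.append_right _, ih.2.append_right _⟩
  | right t _ ih => exact ⟨ih.1.append_left _, ih.2.append_left _⟩

theorem IsOn.of_perm {s t : FreeMagma A} {S : Set A} (h : IsOn s S)
    (p : (leaves s).Perm (leaves t)) : IsOn t S :=
  ⟨p.nodup_iff.1 h.nodup, fun a => (p.mem_iff).symm.trans (h.mem_iff a)⟩

/-- The bracket `Lie(S) × Lie(T) → Lie(S ∪ T)` for disjoint `S` and `T`. -/
def brk {S T U : Set A} (hd : Disjoint S T) (hU : S ∪ T = U) :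
    LieOp k S →ₗ[k] LieOp k T →ₗ[k] LieOp k U :=
  LieOp.lift
    (fun s hs => LieOp.lift (fun t ht => LieOp.mk (s * t) (isOn_mul hs ht hd hU))
      (fun _ _ _ _ h => LieOp.mk_anti _ _ (h.right s))
      (fun _ _ _ _ _ _ h => LieOp.mk_jac _ _ _ (h.right s)))
    (fun _ _ _ _ h => LieOp.hom_ext fun t ht => by simpa using LieOp.mk_anti _ _ (h.left t))
    (fun _ _ _ _ _ _ h => LieOp.hom_ext fun t ht => by
      simpa using LieOp.mk_jac _ _ _ (h.left t))

@[simp] theorem brk_mk {S T U : Set A} (hd : Disjoint S T) (hU : S ∪ T = U)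
    {s t : FreeMagma A} (hs : IsOn s S) (ht : IsOn t T) :
    brk (k := k) hd hU (LieOp.mk s hs) (LieOp.mk t ht) =
      LieOp.mk (s * t) (isOn_mul hs ht hd hU) := by
  simp [brk]

theorem brk_anti {S T U : Set A} (hd : Disjoint S T) (hU : S ∪ T = U) (hd' : Disjoint T S)
    (hU' : T ∪ S = U) (x : LieOp k S) (y : LieOp k T) :
    brk hd hU x y + brk hd' hU' y x = 0 := by
  induction x using LieOp.induct with
  | h0 => simp
  | hadd x x' hx hx' =>
    simp only [map_add, LinearMap.add_apply]
    rw [add_add_add_comm, hx, hx', add_zero]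
  | hsmul c x hx =>
    simp only [map_smul, LinearMap.smul_apply]
    rw [← smul_add, hx, smul_zero]
  | hmk s hs =>
    induction y using LieOp.induct with
    | h0 => simp
    | hadd x x' hx hx' =>
      simp only [map_add, LinearMap.add_apply]
      rw [add_add_add_comm, hx, hx', add_zero]
    | hsmul c x hx =>
      simp only [map_smul, LinearMap.smul_apply]
      rw [← smul_add, hx, smul_zero]
    | hmk t ht =>
      simpa using LieOp.mk_anti _ _ (Anti.swap s t)

theorem brk_jac {R S T RS RT ST U : Set A} (h1 : Disjoint S T) (h2 : S ∪ T = ST)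
    (h3 : Disjoint R ST) (h4 : R ∪ ST = U) (h5 : Disjoint R S) (h6 : R ∪ S = RS)
    (h7 : Disjoint RS T) (h8 : RS ∪ T = U) (h9 : Disjoint R T) (h10 : R ∪ T = RT)
    (h11 : Disjoint RT S) (h12 : RT ∪ S = U) (x : LieOp k R) (y : LieOp k S) (z : LieOp k T) :
    brk h3 h4 x (brk h1 h2 y z) - brk h7 h8 (brk h5 h6 x y) z +
      brk h11 h12 (brk h9 h10 x z) y = 0 := by
  induction x using LieOp.induct with
  | h0 => simp
  | hadd x x' hx hx' =>
    simp only [map_add, LinearMap.add_apply]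
    rw [add_sub_add_comm, add_add_add_comm, hx, hx', add_zero]
  | hsmul c x hx =>
    simp only [map_smul, LinearMap.smul_apply]
    rw [← smul_sub, ← smul_add, hx, smul_zero]
  | hmk r hr =>
    induction y using LieOp.induct with
    | h0 => simp
    | hadd x x' hx hx' =>
      simp only [map_add, LinearMap.add_apply]
      rw [add_sub_add_comm, add_add_add_comm, hx, hx', add_zero]
    | hsmul c x hx =>
      simp only [map_smul, LinearMap.smul_apply]
      rw [← smul_sub, ← smul_add, hx, smul_zero]
    | hmk s hs =>
      induction z using LieOp.induct with
      | h0 => simp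
      | hadd x x' hx hx' =>
        simp only [map_add, LinearMap.add_apply]
        rw [add_sub_add_comm, add_add_add_comm, hx, hx', add_zero]
      | hsmul c x hx =>
        simp only [map_smul, LinearMap.smul_apply]
        rw [← smul_sub, ← smul_add, hx, smul_zero]
      | hmk t ht =>
        simpa using LieOp.mk_jac _ _ _ (Jac.node r s t)

theorem disj_preimage (α : A → B) {S T : Set B} (h : Disjoint S T) :
    Disjoint (α ⁻¹' S) (α ⁻¹' T) := h.preimage α

theorem union_preimage (α : A → B) {S T U : Set B} (h : S ∪ T = U) :
    α ⁻¹' S ∪ α ⁻¹' T = α ⁻¹' U := by rw [← h, Set.preimage_union]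

/-- Substitution into a tree: `f b` is substituted for the leaf `b`, and the vertices of the tree
are replaced by brackets. -/
def substTree (α : A → B) (f : (b : B) → LieOp k (α ⁻¹' {b})) :
    (t : FreeMagma B) → (S : Set B) → IsOn t S → LieOp k (α ⁻¹' S)
  | FreeMagma.of b, _, h => isOn_of_iff.1 h ▸ f b
  | FreeMagma.mul s t, _, h =>
    brk (disj_preimage α (IsOn.disj h)) (union_preimage α (IsOn.union h))
      (substTree α f s (leafSet s) (IsOn.left h)) (substTree α f t (leafSet t) (IsOn.right h))

theorem substTree_of (α : A → B) (f : (b : B) → LieOp k (α ⁻¹' {b})) (b : B)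
    (h : IsOn (FreeMagma.of b) {b}) : substTree α f (FreeMagma.of b) {b} h = f b := rfl

theorem substTree_mul (α : A → B) (f : (b : B) → LieOp k (α ⁻¹' {b})) {s t : FreeMagma B}
    {S T U : Set B} (h : IsOn (s * t) U) (hs : IsOn s S) (ht : IsOn t T) (hd : Disjoint S T)
    (hU : S ∪ T = U) :
    substTree α f (s * t) U h = brk (disj_preimage α hd) (union_preimage α hU)
      (substTree α f s S hs) (substTree α f t T ht) := by
  obtain rfl := hs.eq
  obtain rfl := ht.eq
  rfl

theorem substTree_anti (α : A → B) (f : (b : B) → LieOp k (α ⁻¹' {b})) {s t : FreeMagma B}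
    (h : Anti s t) : ∀ (S : Set B) (hs : IsOn s S) (ht : IsOn t S),
    substTree α f s S hs + substTree α f t S ht = 0 := by
  induction h with
  | swap s t =>
    intro S hs ht
    rw [substTree_mul α f hs hs.left hs.right hs.disj hs.union,
      substTree_mul α f ht hs.right hs.left hs.disj.symm ht.union]
    exact brk_anti _ _ _ _ _ _
  | left t h ih =>
    intro S hs ht
    have h' := hs.left.of_perm h.perm
    rw [substTree_mul α f hs hs.left hs.right hs.disj hs.union,
      substTree_mul α f ht h' hs.right hs.disj hs.union, ← LinearMap.add_apply, ← map_add,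
      ih _ hs.left h']
    simp
  | right t h ih =>
    intro S hs ht
    have h' := hs.right.of_perm h.perm
    rw [substTree_mul α f hs hs.left hs.right hs.disj hs.union,
      substTree_mul α f ht hs.left h' hs.disj hs.union, ← map_add,
      ih _ hs.right h']
    simp

theorem substTree_jac (α : A → B) (f : (b : B) → LieOp k (α ⁻¹' {b})) {x y z : FreeMagma B}
    (h : Jac x y z) : ∀ (S : Set B) (hx : IsOn x S) (hy : IsOn y S) (hz : IsOn z S),
    substTree α f x S hx - substTree α f y S hy + substTree α f z S hz = 0 := by
  induction h with
  | node r s t =>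
    intro S hx hy hz
    rw [substTree_mul α f hx hx.left hx.right hx.disj hx.union,
      substTree_mul α f hx.right hx.right.left hx.right.right hx.right.disj hx.right.union,
      substTree_mul α f hy hy.left hy.right hy.disj hy.union,
      substTree_mul α f hy.left hy.left.left hy.left.right hy.left.disj hy.left.union,
      substTree_mul α f hz hz.left hz.right hz.disj hz.union,
      substTree_mul α f hz.left hz.left.left hz.left.right hz.left.disj hz.left.union]
    exact brk_jac _ _ _ _ _ _ _ _ _ _ _ _ _ _ _
  | left t h ih =>
    intro S hx hy hz
    have hy' := hx.left.of_perm h.perm.1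
    have hz' := hx.left.of_perm h.perm.2
    rw [substTree_mul α f hx hx.left hx.right hx.disj hx.union,
      substTree_mul α f hy hy' hx.right hx.disj hx.union,
      substTree_mul α f hz hz' hx.right hx.disj hx.union,
      ← LinearMap.sub_apply, ← map_sub, ← LinearMap.add_apply, ← map_add,
      ih _ hx.left hy' hz']
    simp
  | right t h ih =>
    intro S hx hy hz
    have hy' := hx.right.of_perm h.perm.1
    have hz' := hx.right.of_perm h.perm.2
    rw [substTree_mul α f hx hx.left hx.right hx.disj hx.union,
      substTree_mul α f hy hx.left hy' hx.disj hx.union,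
      substTree_mul α f hz hx.left hz' hx.disj hx.union,
      ← map_sub, ← map_add, ih _ hx.right hy' hz']
    simp

/-- Operadic composition: for a map `α : A → B`, elements `f b ∈ Lie(α⁻¹(b))` and
`g ∈ Lie(S)` with `S ⊆ B`, the composite `g ∘ (f b)_{b ∈ S} ∈ Lie(α⁻¹(S))`. -/
def subst (α : A → B) (f : (b : B) → LieOp k (α ⁻¹' {b})) (S : Set B) :
    LieOp k S →ₗ[k] LieOp k (α ⁻¹' S) :=
  LieOp.lift (fun t ht => substTree α f t S ht)
    (fun _ _ hs ht h => substTree_anti α f h S hs ht)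
    (fun _ _ _ hx hy hz h => substTree_jac α f h S hx hy hz)

theorem subst_mk (α : A → B) (f : (b : B) → LieOp k (α ⁻¹' {b})) {S : Set B} (t : FreeMagma B)
    (ht : IsOn t S) : subst α f S (LieOp.mk t ht) = substTree α f t S ht := by
  simp [subst]

/-- Substitution is compatible with brackets. -/
theorem subst_brk (α : A → B) (f : (b : B) → LieOp k (α ⁻¹' {b})) {S T U : Set B}
    (hd : Disjoint S T) (hU : S ∪ T = U) (x : LieOp k S) (y : LieOp k T) :
    subst α f U (brk hd hU x y) =
      brk (disj_preimage α hd) (union_preimage α hU) (subst α f S x) (subst α f T y) := by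
  induction x using LieOp.induct with
  | h0 => simp
  | hadd x x' hx hx' => simp only [map_add, LinearMap.add_apply, hx, hx']
  | hsmul c x hx => simp only [map_smul, LinearMap.smul_apply, hx]
  | hmk s hs =>
    induction y using LieOp.induct with
    | h0 => simp
    | hadd x x' hx hx' => simp only [map_add, hx, hx']
    | hsmul c x hx => simp only [map_smul, hx]
    | hmk t ht =>
      rw [brk_mk, subst_mk, subst_mk, subst_mk, substTree_mul α f _ hs ht hd hU]

/-- The operadic composition is associative. -/
theorem subst_subst (α : A → B) (β : B → C) (f : (b : B) → LieOp k (α ⁻¹' {b}))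
    (g : (c : C) → LieOp k (β ⁻¹' {c})) (S : Set C) (x : LieOp k S) :
    subst α f (β ⁻¹' S) (subst β g S x) =
      subst (β ∘ α) (fun c => subst α f (β ⁻¹' {c}) (g c)) S x := by
  induction x using LieOp.induct with
  | h0 => simp
  | hadd x y hx hy => rw [map_add, map_add, map_add, hx, hy]
  | hsmul c x hx => rw [map_smul, map_smul, map_smul, hx]
  | hmk t ht =>
    rw [subst_mk, subst_mk]
    induction t generalizing S with
    | ih1 c =>
      obtain rfl := isOn_of_iff.1 ht
      rfl
    | ih2 s t hs' ht' =>
      rw [substTree_mul β g ht ht.left ht.right ht.disj ht.union,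
        substTree_mul (β ∘ α) _ ht ht.left ht.right ht.disj ht.union, subst_brk,
        hs' _ ht.left, ht' _ ht.right]

/-- The operadic unit: the tree with one leaf and no vertex. -/
def one (a : A) : LieOp k ({a} : Set A) := LieOp.mk (FreeMagma.of a) (isOn_of_iff.2 rfl)

theorem subst_one (α : A → B) (f : (b : B) → LieOp k (α ⁻¹' {b})) (b : B) :
    subst α f {b} (one b) = f b := by
  rw [one, subst_mk]
  rfl

theorem one_subst (S : Set A) (x : LieOp k S) : subst id (fun a => one a) S x = x := by
  induction x using LieOp.induct with
  | h0 => exact map_zero _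
  | hadd x y hx hy => exact (map_add _ _ _).trans (congrArg₂ _ hx hy)
  | hsmul c x hx => exact (map_smul _ _ _).trans (congrArg _ hx)
  | hmk t ht =>
    rw [subst_mk]
    induction t generalizing S with
    | ih1 c =>
      obtain rfl := isOn_of_iff.1 ht
      rfl
    | ih2 s t hs' ht' =>
      rw [substTree_mul id _ ht ht.left ht.right ht.disj ht.union, hs' _ ht.left, ht' _ ht.right]
      exact brk_mk _ _ _ _

theorem substTree_congr (α : A → B) {f f' : (b : B) → LieOp k (α ⁻¹' {b})} (t : FreeMagma B)
    (S : Set B) (ht : IsOn t S) (h : ∀ b ∈ S, f b = f' b) :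
    substTree α f t S ht = substTree α f' t S ht := by
  induction t generalizing S with
  | ih1 c =>
    obtain rfl := isOn_of_iff.1 ht
    exact h c rfl
  | ih2 s t hs' ht' =>
    rw [substTree_mul α f ht ht.left ht.right ht.disj ht.union,
      substTree_mul α f' ht ht.left ht.right ht.disj ht.union,
      hs' _ ht.left fun b hb => h b (ht.union ▸ Or.inl hb),
      ht' _ ht.right fun b hb => h b (ht.union ▸ Or.inr hb)]

theorem subst_congr (α : A → B) {f f' : (b : B) → LieOp k (α ⁻¹' {b})}
    (S : Set B) (h : ∀ b ∈ S, f b = f' b) : subst α f S = subst α f' S :=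
  LieOp.hom_ext fun t ht => by rw [subst_mk, subst_mk, substTree_congr α t S ht h]

theorem substTree_update_add [DecidableEq B] (α : A → B) (f : (b : B) → LieOp k (α ⁻¹' {b}))
    (b : B) (x y : LieOp k (α ⁻¹' {b})) (t : FreeMagma B) (S : Set B) (ht : IsOn t S)
    (hb : b ∈ S) :
    substTree α (Function.update f b (x + y)) t S ht =
      substTree α (Function.update f b x) t S ht +
        substTree α (Function.update f b y) t S ht := by
  induction t generalizing S with
  | ih1 c =>
    obtain rfl := isOn_of_iff.1 ht
    obtain rfl : b = c := hb
    simp [substTree_of]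
  | ih2 s t hs' ht' =>
    simp only [substTree_mul α _ ht ht.left ht.right ht.disj ht.union]
    rcases ht.union.symm ▸ hb with h | h
    · have hn : ∀ z, substTree α (Function.update f b z) t _ ht.right =
          substTree α f t _ ht.right := fun z =>
        substTree_congr α t _ ht.right fun c hc => Function.update_of_ne
          (by rintro rfl; exact Set.disjoint_left.1 ht.disj h hc) _ _
      rw [hs' _ ht.left h, hn, hn, hn, map_add, LinearMap.add_apply]
    · have hn : ∀ z, substTree α (Function.update f b z) s _ ht.left =
          substTree α f s _ ht.left := fun z =>
        substTree_congr α s _ ht.left fun c hc => Function.update_of_ne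
          (by rintro rfl; exact Set.disjoint_left.1 ht.disj hc h) _ _
      rw [ht' _ ht.right h, hn, hn, hn, map_add]

theorem substTree_update_smul [DecidableEq B] (α : A → B) (f : (b : B) → LieOp k (α ⁻¹' {b}))
    (b : B) (r : k) (x : LieOp k (α ⁻¹' {b})) (t : FreeMagma B) (S : Set B) (ht : IsOn t S)
    (hb : b ∈ S) :
    substTree α (Function.update f b (r • x)) t S ht =
      r • substTree α (Function.update f b x) t S ht := by
  induction t generalizing S with
  | ih1 c =>
    obtain rfl := isOn_of_iff.1 ht
    obtain rfl : b = c := hb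
    simp [substTree_of]
  | ih2 s t hs' ht' =>
    simp only [substTree_mul α _ ht ht.left ht.right ht.disj ht.union]
    rcases ht.union.symm ▸ hb with h | h
    · have hn : ∀ z, substTree α (Function.update f b z) t _ ht.right =
          substTree α f t _ ht.right := fun z =>
        substTree_congr α t _ ht.right fun c hc => Function.update_of_ne
          (by rintro rfl; exact Set.disjoint_left.1 ht.disj h hc) _ _
      rw [hs' _ ht.left h, hn, hn, map_smul, LinearMap.smul_apply]
    · have hn : ∀ z, substTree α (Function.update f b z) s _ ht.left =
          substTree α f s _ ht.left := fun z =>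
        substTree_congr α s _ ht.left fun c hc => Function.update_of_ne
          (by rintro rfl; exact Set.disjoint_left.1 ht.disj hc h) _ _
      rw [ht' _ ht.right h, hn, hn, map_smul]

theorem subst_update_add [DecidableEq B] (α : A → B) (f : (b : B) → LieOp k (α ⁻¹' {b}))
    (b : B) (x y : LieOp k (α ⁻¹' {b})) (S : Set B) (hb : b ∈ S) :
    subst α (Function.update f b (x + y)) S =
      subst α (Function.update f b x) S + subst α (Function.update f b y) S :=
  LieOp.hom_ext fun t ht => by
    simp only [LinearMap.add_apply, subst_mk, substTree_update_add α f b x y t S ht hb]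

theorem subst_update_smul [DecidableEq B] (α : A → B) (f : (b : B) → LieOp k (α ⁻¹' {b}))
    (b : B) (r : k) (x : LieOp k (α ⁻¹' {b})) (S : Set B) (hb : b ∈ S) :
    subst α (Function.update f b (r • x)) S = r • subst α (Function.update f b x) S :=
  LieOp.hom_ext fun t ht => by
    simp only [LinearMap.smul_apply, subst_mk, substTree_update_smul α f b r x t S ht hb]

end


/-! ### The linear category `Γ_sh^Lie` -/

/-- The pointed shuffling surjections `[n] → [m]`, where `[n] = {0, ..., n}` has base point `0`:
`min α⁻¹(i) < min α⁻¹(j)` whenever `i < j`. As `Lie(∅) = 0`, maps that are not surjective would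
contribute nothing to the morphisms below. -/
@[ext]
structure ShMap (n m : ℕ) where
  toFun : Fin (n + 1) → Fin (m + 1)
  map_zero : toFun 0 = 0
  surj : Function.Surjective toFun
  shuffle : ∀ i j, i < j → sInf (toFun ⁻¹' {i}) < sInf (toFun ⁻¹' {j})

theorem shuffle_of {n m : ℕ} {α : Fin (n + 1) → Fin (m + 1)} (hs : Function.Surjective α)
    (h : ∀ i y, i < α y → ∃ x, α x = i ∧ x < y) (i j : Fin (m + 1)) (hij : i < j) :
    sInf (α ⁻¹' {i}) < sInf (α ⁻¹' {j}) := by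
  obtain ⟨y, hy⟩ := hs j
  have h1 : sInf (α ⁻¹' {j}) ∈ α ⁻¹' {j} := Set.Nonempty.csInf_mem ⟨y, hy⟩ (Set.toFinite _)
  obtain ⟨x, hx, hxy⟩ := h i (sInf (α ⁻¹' {j})) (by rw [show α _ = j from h1]; exact hij)
  exact lt_of_le_of_lt (csInf_le (Set.toFinite _).bddBelow hx) hxy

theorem ShMap.exists_lt {n m : ℕ} (α : ShMap n m) (i : Fin (m + 1)) (y : Fin (n + 1))
    (h : i < α.toFun y) : ∃ x, α.toFun x = i ∧ x < y := by
  obtain ⟨x, hx⟩ := α.surj i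
  refine ⟨sInf (α.toFun ⁻¹' {i}), Set.Nonempty.csInf_mem (s := α.toFun ⁻¹' {i}) ⟨x, hx⟩
    (Set.toFinite _), ?_⟩
  exact lt_of_lt_of_le (α.shuffle _ _ h) (csInf_le (Set.toFinite _).bddBelow rfl)

namespace ShMap

instance (n m : ℕ) : DecidableEq (ShMap n m) := fun α β =>
  decidable_of_iff (α.toFun = β.toFun) ShMap.ext_iff.symm

/-- The identity of `[n]`. -/
def id (n : ℕ) : ShMap n n where
  toFun := _root_.id
  map_zero := rfl
  surj := Function.surjective_id
  shuffle := shuffle_of Function.surjective_id fun i _ h => ⟨i, rfl, h⟩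

/-- The composite `β ∘ α`. -/
def comp {n m p : ℕ} (α : ShMap n m) (β : ShMap m p) : ShMap n p where
  toFun := β.toFun ∘ α.toFun
  map_zero := by simp [α.map_zero, β.map_zero]
  surj := β.surj.comp α.surj
  shuffle := shuffle_of (β.surj.comp α.surj) fun i y h => by
    obtain ⟨a, ha, hay⟩ := β.exists_lt i (α.toFun y) h
    obtain ⟨x, hx, hxy⟩ := α.exists_lt a y hay
    exact ⟨x, by simp [hx, ha], hxy⟩

end ShMap

open scoped TensorProduct in
/-- `Lie(α⁻¹(0)) ⊗ ... ⊗ Lie(α⁻¹(m))`. -/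
abbrev LieTensor (k : Type*) [CommRing k] {n m : ℕ} (α : ShMap n m) : Type _ :=
  ⨂[k] i : Fin (m + 1), LieOp k (α.toFun ⁻¹' {i})

/-- The `k`-module `Γ_sh^Lie([n],[m]) = ⨁_α Lie(α⁻¹(0)) ⊗ ... ⊗ Lie(α⁻¹(m))`. -/
abbrev HomMod (k : Type*) [CommRing k] (n m : ℕ) : Type _ :=
  DirectSum (ShMap n m) fun α => LieTensor k α

section

variable {k : Type*} [CommRing k]

/-- The generator `(α, f_0 ⊗ ... ⊗ f_m)` of `Γ_sh^Lie([n],[m])`. -/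
def gen {n m : ℕ} (α : ShMap n m) (f : (i : Fin (m + 1)) → LieOp k (α.toFun ⁻¹' {i})) :
    HomMod k n m :=
  DirectSum.lof k (ShMap n m) (fun α => LieTensor k α) α (PiTensorProduct.tprod k f)

/-- For `f_i ∈ Lie(α⁻¹(i))` and `g_j ∈ Lie(β⁻¹(j))`, the operadic composite of `g_j` with the
`f_i`, `i ∈ β⁻¹(j)`, as an element of `Lie((β ∘ α)⁻¹(j))`. -/
def substAt {n m p : ℕ} (α : ShMap n m) (β : ShMap m p)
    (f : (i : Fin (m + 1)) → LieOp k (α.toFun ⁻¹' {i})) (j : Fin (p + 1)) :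
    LieOp k (β.toFun ⁻¹' {j}) →ₗ[k] LieOp k ((α.comp β).toFun ⁻¹' {j}) :=
  subst α.toFun f (β.toFun ⁻¹' {j})

theorem substAt_update {n m p : ℕ} (α : ShMap n m) (β : ShMap m p) [DecidableEq (Fin (m + 1))]
    (f : (i : Fin (m + 1)) → LieOp k (α.toFun ⁻¹' {i})) (i : Fin (m + 1))
    (z : LieOp k (α.toFun ⁻¹' {i})) :
    (fun j => substAt α β (Function.update f i z) j) =
      Function.update (fun j => substAt α β f j) (β.toFun i)
        (substAt α β (Function.update f i z) (β.toFun i)) := by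
  funext j
  by_cases hj : j = β.toFun i
  · subst hj
    simp
  · rw [Function.update_of_ne hj]
    refine subst_congr _ _ fun b hb => Function.update_of_ne ?_ _ _
    rintro rfl
    exact hj hb.symm

/-- For `f_i ∈ Lie(α⁻¹(i))`, the map `g_0 ⊗ ... ⊗ g_p ↦ h_0 ⊗ ... ⊗ h_p`, where
`h_j ∈ Lie((β ∘ α)⁻¹(j))` is the operadic composite of `g_j ∈ Lie(β⁻¹(j))` with the `f_i`,
`i ∈ β⁻¹(j)`; it is multilinear in `f`. -/
def compTensorAux {n m p : ℕ} (α : ShMap n m) (β : ShMap m p) :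
    MultilinearMap k (fun i : Fin (m + 1) => LieOp k (α.toFun ⁻¹' {i}))
      (LieTensor k β →ₗ[k] LieTensor k (α.comp β)) where
  toFun f := PiTensorProduct.map fun j => substAt α β f j
  map_update_add' f i x y := by
    have h : substAt α β (Function.update f i (x + y)) (β.toFun i) =
        substAt α β (Function.update f i x) (β.toFun i) +
          substAt α β (Function.update f i y) (β.toFun i) :=
      subst_update_add α.toFun f i x y (β.toFun ⁻¹' {β.toFun i}) rfl
    rw [substAt_update, substAt_update α β f i x, substAt_update α β f i y, h,
      PiTensorProduct.map_update_add]
  map_update_smul' f i c x := by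
    have h : substAt α β (Function.update f i (c • x)) (β.toFun i) =
        c • substAt α β (Function.update f i x) (β.toFun i) :=
      subst_update_smul α.toFun f i c x (β.toFun ⁻¹' {β.toFun i}) rfl
    rw [substAt_update, substAt_update α β f i x, h, PiTensorProduct.map_update_smul]

/-- The linear extension of `compTensorAux` to the tensor product of the `Lie(α⁻¹(i))`. -/
def compTensor {n m p : ℕ} (α : ShMap n m) (β : ShMap m p) :
    LieTensor k α →ₗ[k] LieTensor k β →ₗ[k] LieTensor k (α.comp β) :=
  PiTensorProduct.lift (compTensorAux α β)

/-- The bilinear composition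
`Γ_sh^Lie([n],[m]) × Γ_sh^Lie([m],[p]) → Γ_sh^Lie([n],[p])`. -/
def compHom (n m p : ℕ) : HomMod k n m →ₗ[k] HomMod k m p →ₗ[k] HomMod k n p :=
  DirectSum.toModule k _ _ fun α => LinearMap.flip <|
    DirectSum.toModule k _ _ fun β => LinearMap.flip <|
      (LinearMap.compRight k (DirectSum.lof k (ShMap n p) (fun α => LieTensor k α) (α.comp β))).comp
        (compTensor α β)

theorem compHom_gen {n m p : ℕ} (α : ShMap n m) (β : ShMap m p)
    (f : (i : Fin (m + 1)) → LieOp k (α.toFun ⁻¹' {i}))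
    (g : (i : Fin (p + 1)) → LieOp k (β.toFun ⁻¹' {i})) :
    compHom n m p (gen α f) (gen β g) =
      gen (α.comp β) fun j => substAt α β f j (g j) := by
  simp only [compHom, gen, DirectSum.toModule_lof, LinearMap.flip_apply]
  simp only [LinearMap.comp_apply, LinearMap.compRight_apply, compTensor,
    PiTensorProduct.lift.tprod]
  simp [compTensorAux]

theorem homMod_ext {n m : ℕ} {M : Type*} [AddCommGroup M] [Module k M]
    {φ ψ : HomMod k n m →ₗ[k] M} (h : ∀ α f, φ (gen α f) = ψ (gen α f)) : φ = ψ := by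
  refine DirectSum.linearMap_ext k fun α => PiTensorProduct.ext ?_
  ext f
  exact h α f

theorem homMod_induct {n m : ℕ} {P : HomMod k n m → Prop} (h0 : P 0)
    (hadd : ∀ x y, P x → P y → P (x + y)) (hsmul : ∀ (c : k) x, P x → P (c • x))
    (hgen : ∀ α f, P (gen α f)) (x : HomMod k n m) : P x := by
  induction x using DirectSum.induction_on with
  | zero => exact h0
  | add x y hx hy => exact hadd x y hx hy
  | of α x =>
    induction x using PiTensorProduct.induction_on with
    | smul_tprod r f =>
      have := hsmul r _ (hgen α f)
      rwa [gen, ← map_smul] at this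
    | add x y hx hy =>
      rw [map_add]
      exact hadd _ _ hx hy

/-- The operadic unit in each `Lie({i})`. -/
def ones (n : ℕ) (i : Fin (n + 1)) : LieOp k ((ShMap.id n).toFun ⁻¹' {i}) := one i

/-- The identity of `[n]` in `Γ_sh^Lie`. -/
def idHom (n : ℕ) : HomMod k n n := gen (ShMap.id n) (ones n)

theorem idHom_comp {n m : ℕ} (x : HomMod k n m) : compHom n n m (idHom n) x = x := by
  induction x using homMod_induct with
  | h0 => simp
  | hadd x y hx hy => rw [map_add, hx, hy]
  | hsmul c x hx => rw [map_smul, hx]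
  | hgen α f =>
    rw [idHom, compHom_gen]
    have : (fun j => substAt (ShMap.id n) α (ones n) j (f j)) = f :=
      funext fun j => one_subst _ (f j)
    exact congrArg (gen α) this

theorem comp_idHom {n m : ℕ} (x : HomMod k n m) : compHom n m m x (idHom m) = x := by
  induction x using homMod_induct with
  | h0 => simp
  | hadd x y hx hy => rw [map_add, LinearMap.add_apply, hx, hy]
  | hsmul c x hx => rw [map_smul, LinearMap.smul_apply, hx]
  | hgen α f =>
    rw [idHom, compHom_gen]
    have : (fun j => substAt α (ShMap.id m) f j (ones m j)) = f :=
      funext fun j => subst_one _ f j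
    exact congrArg (gen α) this

theorem compHom_assoc {n m p q : ℕ} (x : HomMod k n m) (y : HomMod k m p) (z : HomMod k p q) :
    compHom n p q (compHom n m p x y) z = compHom n m q x (compHom m p q y z) := by
  induction x using homMod_induct with
  | h0 => simp
  | hadd x x' hx hx' => simp only [map_add, LinearMap.add_apply, hx, hx']
  | hsmul c x hx => simp only [map_smul, LinearMap.smul_apply, hx]
  | hgen α f =>
    induction y using homMod_induct with
    | h0 => simp
    | hadd x x' hx hx' => simp only [map_add, LinearMap.add_apply, hx, hx']
    | hsmul c x hx => simp only [map_smul, LinearMap.smul_apply, hx]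
    | hgen β g =>
      induction z using homMod_induct with
      | h0 => simp
      | hadd x x' hx hx' => simp only [map_add, hx, hx']
      | hsmul c x hx => simp only [map_smul, hx]
      | hgen γ h =>
        rw [compHom_gen, compHom_gen, compHom_gen, compHom_gen]
        have : (fun j => substAt α (β.comp γ) f j (substAt β γ g j (h j))) =
            fun j => substAt (α.comp β) γ (fun c => substAt α β f c (g c)) j (h j) :=
          funext fun j => subst_subst α.toFun β.toFun f g _ (h j)
        exact (congrArg (gen (α.comp (β.comp γ))) this).symm

theorem add_compHom {n m p : ℕ} (x y : HomMod k n m) (z : HomMod k m p) :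
    compHom n m p (x + y) z = compHom n m p x z + compHom n m p y z :=
  LinearMap.map_add₂ _ x y z

theorem compHom_add {n m p : ℕ} (x : HomMod k n m) (y z : HomMod k m p) :
    compHom n m p x (y + z) = compHom n m p x y + compHom n m p x z :=
  map_add _ y z

theorem compHom_smul {n m p : ℕ} (r : k) (x : HomMod k n m) (z : HomMod k m p) :
    compHom n m p x (r • z) = r • compHom n m p x z :=
  map_smul _ r z

theorem smul_compHom {n m p : ℕ} (r : k) (x : HomMod k n m) (z : HomMod k m p) :
    compHom n m p (r • x) z = r • compHom n m p x z :=
  LinearMap.map_smul₂ _ r x z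

end

/-- The category `Γ_sh^Lie` over `k`; its objects are the pointed sets `[n]`, `n ≥ 0`. -/
structure GammaShLie (k : Type*) [CommRing k] where
  /-- The object `[n]`. -/
  obj ::
  /-- The number `n` of the object `[n]`. -/
  deg : ℕ

section

variable {k : Type*} [CommRing k]

instance : CategoryTheory.Category (GammaShLie k) where
  Hom a b := HomMod k a.deg b.deg
  id a := idHom a.deg
  comp {a b c} x y := compHom a.deg b.deg c.deg x y
  id_comp x := idHom_comp x
  comp_id x := comp_idHom x
  assoc x y z := compHom_assoc x y z

instance : CategoryTheory.Preadditive (GammaShLie k) where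
  homGroup a b := inferInstanceAs (AddCommGroup (HomMod k a.deg b.deg))
  add_comp _ _ _ x y z := add_compHom x y z
  comp_add _ _ _ x y z := compHom_add x y z

instance : CategoryTheory.Linear k (GammaShLie k) where
  homModule a b := inferInstanceAs (Module k (HomMod k a.deg b.deg))
  smul_comp _ _ _ r x y := smul_compHom r x y
  comp_smul _ _ _ x r y := compHom_smul r x y

end

/-! ### The Leibniz complex -/

section

variable {k : Type*} [CommRing k]

/-- The only shuffling map `[n+1] → [n]` that sends both `i` and `j` to `i`, where `i < j`. -/
def contr {n : ℕ} (i j : Fin (n + 2)) (h : i < j) : ShMap (n + 1) n where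
  toFun x := ⟨if x.1 < j.1 then x.1 else if x.1 = j.1 then i.1 else x.1 - 1, by
    have := x.2; have := j.2; have : i.1 < j.1 := h; split_ifs <;> omega⟩
  map_zero := by
    have : i.1 < j.1 := h
    ext
    simp
    omega
  surj y := by
    by_cases hy : y.1 < j.1
    · exact ⟨y.castSucc, by ext; simp [hy]⟩
    · refine ⟨y.succ, ?_⟩
      ext
      simp only [Fin.val_succ]
      split_ifs <;> omega
  shuffle := by
    have hij : i.1 < j.1 := h
    refine shuffle_of (fun y => ?_) fun a y hay => ?_
    · by_cases hy : y.1 < j.1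
      · exact ⟨y.castSucc, by ext; simp [hy]⟩
      · refine ⟨y.succ, ?_⟩
        ext
        simp only [Fin.val_succ]
        split_ifs <;> omega
    · rw [Fin.lt_def] at hay
      simp only at hay
      by_cases ha : a.1 < j.1
      · refine ⟨a.castSucc, by ext; simp [ha], ?_⟩
        rw [Fin.lt_def, Fin.val_castSucc]
        split_ifs at hay <;> omega
      · refine ⟨a.succ, ?_, ?_⟩
        · ext
          simp only [Fin.val_succ]
          split_ifs <;> omega
        · rw [Fin.lt_def, Fin.val_succ]
          split_ifs at hay <;> omega

/-- The trees of `d_{i,j}`: the bracket of `i` and `j` at the place of `i`, and the trivial tree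
at every other label different from `j`. (`j.succAbove : [n] → [n+1]` is the increasing map that
skips `j`.) -/
def dTree {n : ℕ} (i j : Fin (n + 2)) (l : Fin (n + 1)) : FreeMagma (Fin (n + 2)) :=
  if j.succAbove l = i then FreeMagma.of i * FreeMagma.of j else FreeMagma.of (j.succAbove l)

theorem isOn_dTree {n : ℕ} (i j : Fin (n + 2)) (h : i < j) (l : Fin (n + 1)) :
    IsOn (dTree i j l) ((contr i j h).toFun ⁻¹' {l}) := by
  have hij : i.1 < j.1 := h
  unfold dTree
  split_ifs with h1
  · refine isOn_mul (isOn_of_iff.2 rfl) (isOn_of_iff.2 rfl) (by simpa using h.ne) ?_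
    ext x
    subst h1
    simp only [contr, Fin.succAbove, Fin.lt_def, Fin.ext_iff, Set.mem_preimage,
      Set.mem_singleton_iff, Set.mem_union, Fin.val_castSucc] at hij ⊢
    split_ifs at hij ⊢ <;> simp at hij ⊢ <;> omega
  · refine isOn_of_iff.2 ?_
    ext x
    simp only [contr, Fin.succAbove, Fin.lt_def, Fin.ext_iff, Set.mem_preimage,
      Set.mem_singleton_iff, Fin.val_castSucc] at h1 ⊢
    split_ifs at h1 ⊢ <;> simp at h1 ⊢ <;> omega

/-- The morphism `d_{i,j} ∈ Γ_sh^Lie([n+1],[n])`, for `0 ≤ i < j ≤ n+1`. -/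
def dMor {n : ℕ} (i j : Fin (n + 2)) (h : i < j) : HomMod k (n + 1) n :=
  gen (contr i j h) fun l => LieOp.mk (dTree i j l) (isOn_dTree i j h l)

/-- `∑_{0 ≤ i < j ≤ n+1} (-1)^j d_{i,j} ∈ Γ_sh^Lie([n+1],[n])`. -/
def diff (k : Type*) [CommRing k] (n : ℕ) : HomMod k (n + 1) n :=
  ∑ q : {q : Fin (n + 2) × Fin (n + 2) // q.1 < q.2},
    (-1 : k) ^ (q.1.2 : ℕ) • dMor q.1.1 q.1.2 q.2

/-- A family of trees whose leaves partition `[n]` in a shuffling way. -/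
def IsForest {n m : ℕ} (F : Fin (m + 1) → FreeMagma (Fin (n + 1))) : Prop :=
  ∃ α : ShMap n m, ∀ l, IsOn (F l) (α.toFun ⁻¹' {l})

open Classical in
/-- The generator given by a family of trees. -/
def cls {n m : ℕ} (F : Fin (m + 1) → FreeMagma (Fin (n + 1))) : HomMod k n m :=
  if h : IsForest F then gen h.choose fun l => LieOp.mk (F l) (h.choose_spec l) else 0

theorem gen_mk {n m : ℕ} (F : Fin (m + 1) → FreeMagma (Fin (n + 1))) (α : ShMap n m)
    (h : ∀ l, IsOn (F l) (α.toFun ⁻¹' {l})) :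
    (gen α fun l => LieOp.mk (F l) (h l) : HomMod k n m) = cls F := by
  have hF : IsForest F := ⟨α, h⟩
  have key : ∀ β : ShMap n m, ∀ h' : ∀ l, IsOn (F l) (β.toFun ⁻¹' {l}),
      (gen α fun l => LieOp.mk (F l) (h l) : HomMod k n m) =
        gen β fun l => LieOp.mk (F l) (h' l) := by
    intro β h'
    obtain rfl : α = β := by
      ext1
      funext x
      have h1 := ((h (α.toFun x)).mem_iff x).2 rfl
      exact (((h' (α.toFun x)).mem_iff x).1 h1).symm
    rfl
  rw [cls, dif_pos hF]
  exact key _ _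

theorem isOn_lift {A B : Type} (α : A → B) (F : B → FreeMagma A)
    (h : ∀ b, IsOn (F b) (α ⁻¹' {b})) (t : FreeMagma B) (S : Set B) (ht : IsOn t S) :
    IsOn (FreeMagma.lift F t) (α ⁻¹' S) := by
  induction t generalizing S with
  | ih1 c =>
    obtain rfl := isOn_of_iff.1 ht
    simpa using h c
  | ih2 s t hs' ht' =>
    rw [map_mul]
    exact isOn_mul (hs' _ ht.left) (ht' _ ht.right) (disj_preimage α ht.disj)
      (union_preimage α ht.union)

theorem substTree_lift {A B : Type} (α : A → B) (F : B → FreeMagma A)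
    (h : ∀ b, IsOn (F b) (α ⁻¹' {b})) (t : FreeMagma B) (S : Set B) (ht : IsOn t S) :
    substTree (k := k) α (fun b => LieOp.mk (F b) (h b)) t S ht =
      LieOp.mk (FreeMagma.lift F t) (isOn_lift α F h t S ht) := by
  induction t generalizing S with
  | ih1 c =>
    obtain rfl := isOn_of_iff.1 ht
    rfl
  | ih2 s t hs' ht' =>
    rw [substTree_mul α _ ht ht.left ht.right ht.disj ht.union, hs' _ ht.left, ht' _ ht.right,
      brk_mk]
    rfl

theorem isForest_lift {n m p : ℕ} {F : Fin (m + 1) → FreeMagma (Fin (n + 1))}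
    {G : Fin (p + 1) → FreeMagma (Fin (m + 1))} (hF : IsForest F) (hG : IsForest G) :
    IsForest fun l => FreeMagma.lift F (G l) := by
  obtain ⟨α, hα⟩ := hF
  obtain ⟨β, hβ⟩ := hG
  exact ⟨α.comp β, fun l => isOn_lift α.toFun F hα (G l) _ (hβ l)⟩

theorem compHom_cls {n m p : ℕ} {F : Fin (m + 1) → FreeMagma (Fin (n + 1))}
    {G : Fin (p + 1) → FreeMagma (Fin (m + 1))} (hF : IsForest F) (hG : IsForest G) :
    compHom n m p (cls F) (cls G) = (cls fun l => FreeMagma.lift F (G l) : HomMod k n p) := by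
  obtain ⟨α, hα⟩ := hF
  obtain ⟨β, hβ⟩ := hG
  rw [← gen_mk F α hα, ← gen_mk G β hβ, compHom_gen,
    ← gen_mk _ (α.comp β) fun l => isOn_lift α.toFun F hα (G l) _ (hβ l)]
  congr 1
  funext j
  refine (subst_mk α.toFun _ (G j) (hβ j)).trans ?_
  exact substTree_lift α.toFun F hα (G j) _ (hβ j)

theorem cls_jac {n m : ℕ} {F G H : Fin (m + 1) → FreeMagma (Fin (n + 1))} (hF : IsForest F)
    (l : Fin (m + 1)) (hl : Jac (F l) (G l) (H l)) (hG : ∀ i, i ≠ l → G i = F i)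
    (hH : ∀ i, i ≠ l → H i = F i) : (cls F - cls G + cls H : HomMod k n m) = 0 := by
  obtain ⟨α, hα⟩ := hF
  have hα' : ∀ i, IsOn (G i) (α.toFun ⁻¹' {i}) := fun i => by
    by_cases h : i = l
    · subst h; exact (hα i).of_perm hl.perm.1
    · rw [hG i h]; exact hα i
  have hα'' : ∀ i, IsOn (H i) (α.toFun ⁻¹' {i}) := fun i => by
    by_cases h : i = l
    · subst h; exact (hα i).of_perm hl.perm.2
    · rw [hH i h]; exact hα i
  have e1 : (fun i => LieOp.mk (k := k) (G i) (hα' i)) =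
      Function.update (fun i => LieOp.mk (k := k) (F i) (hα i)) l (LieOp.mk (G l) (hα' l)) := by
    funext i
    by_cases h : i = l
    · subst h; simp
    · rw [Function.update_of_ne h]; simp only [hG i h]
  have e2 : (fun i => LieOp.mk (k := k) (H i) (hα'' i)) =
      Function.update (fun i => LieOp.mk (k := k) (F i) (hα i)) l (LieOp.mk (H l) (hα'' l)) := by
    funext i
    by_cases h : i = l
    · subst h; simp
    · rw [Function.update_of_ne h]; simp only [hH i h]
  have e0 := (Function.update_eq_self l (fun i => LieOp.mk (k := k) (F i) (hα i))).symm
  rw [← gen_mk F α hα, ← gen_mk G α hα', ← gen_mk H α hα'', e1, e2, e0, gen, gen, gen, ← map_sub,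
    ← map_add]
  simp only [Function.update_idem]
  rw [← MultilinearMap.map_update_sub, ← MultilinearMap.map_update_add,
    LieOp.mk_jac (hα l) (hα' l) (hα'' l) hl, MultilinearMap.map_update_zero, map_zero]

theorem isForest_dTree {n : ℕ} (i j : Fin (n + 2)) (h : i < j) : IsForest (dTree i j) :=
  ⟨contr i j h, isOn_dTree i j h⟩

theorem dMor_eq {n : ℕ} (i j : Fin (n + 2)) (h : i < j) :
    (dMor i j h : HomMod k (n + 1) n) = cls (dTree i j) := gen_mk _ _ _

/-- The increasing map that skips `j` and `b`. -/
def skip {n : ℕ} (j b : Fin (n + 3)) (m : Fin (n + 1)) : Fin (n + 3) :=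
  if m.1 < min j.1 b.1 then ⟨m.1, by omega⟩ else
    if m.1 + 1 < max j.1 b.1 then ⟨m.1 + 1, by omega⟩ else ⟨m.1 + 2, by omega⟩

/-- The trees of a composite of two morphisms `d`: first `j` is bracketed into `i`, then `b`
is bracketed into `a`. -/
def ddTree {n : ℕ} (i j a b : Fin (n + 3)) (m : Fin (n + 1)) : FreeMagma (Fin (n + 3)) :=
  let T : Fin (n + 3) → FreeMagma (Fin (n + 3)) := fun y =>
    if y = i then FreeMagma.of i * FreeMagma.of j else FreeMagma.of y
  if skip j b m = a then T a * T b else T (skip j b m)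

theorem skip_eq {n : ℕ} (j : Fin (n + 3)) (l : Fin (n + 2)) (m : Fin (n + 1)) :
    skip j (j.succAbove l) m = j.succAbove (l.succAbove m) := by
  ext
  simp only [skip, Fin.succAbove, Fin.lt_def]
  split_ifs <;> simp at * <;> omega

theorem lift_dTree {n : ℕ} (i j : Fin (n + 3)) (a b : Fin (n + 2)) :
    (fun m => FreeMagma.lift (dTree i j) (dTree a b m)) =
      ddTree i j (j.succAbove a) (j.succAbove b) := by
  funext m
  simp only [ddTree, skip_eq, dTree, (Fin.succAbove_right_injective (p := j)).eq_iff]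
  split_ifs with h1 <;> simp_all [dTree]

/-- The indices of a composite of two morphisms `d`. -/
def quads (n : ℕ) : Finset (Fin n × Fin n × Fin n × Fin n) :=
  {q | q.1 < q.2.1 ∧ q.2.2.1 < q.2.2.2 ∧ q.2.2.1 ≠ q.2.1 ∧ q.2.2.2 ≠ q.2.1}

/-- The summand of `d ∘ d` with given indices. -/
def ddTerm (k : Type*) [CommRing k] {n : ℕ}
    (q : Fin (n + 3) × Fin (n + 3) × Fin (n + 3) × Fin (n + 3)) : HomMod k (n + 2) n :=
  (-1 : k) ^ (q.2.1.1 + if q.2.2.2 < q.2.1 then q.2.2.2.1 else q.2.2.2.1 + 1) •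
    cls (ddTree q.1 q.2.1 q.2.2.1 q.2.2.2)

theorem isForest_ddTree {n : ℕ} {i j a b : Fin (n + 3)} (h : (i, j, a, b) ∈ quads (n + 3)) :
    IsForest (ddTree i j a b) := by
  simp only [quads, Finset.mem_filter, Finset.mem_univ, true_and] at h
  obtain ⟨h1, h2, h3, h4⟩ := h
  obtain ⟨a, rfl⟩ := Fin.exists_succAbove_eq h3
  obtain ⟨b, rfl⟩ := Fin.exists_succAbove_eq h4
  rw [← lift_dTree]
  exact isForest_lift (isForest_dTree i j h1)
    (isForest_dTree a b ((Fin.strictMono_succAbove j).lt_iff_lt.1 h2))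

theorem compHom_dMor {n : ℕ} (i j : Fin (n + 3)) (h : i < j) (a b : Fin (n + 2)) (h' : a < b) :
    (-1 : k) ^ (b : ℕ) • (-1 : k) ^ (j : ℕ) • compHom (n + 2) (n + 1) n (dMor i j h) (dMor a b h') =
      ddTerm k (i, j, j.succAbove a, j.succAbove b) := by
  rw [dMor_eq, dMor_eq, compHom_cls (isForest_dTree i j h) (isForest_dTree a b h'), lift_dTree,
    smul_smul, ddTerm, ← pow_add]
  congr 1
  simp only
  by_cases hb : b.castSucc < j
  · rw [Fin.succAbove_of_castSucc_lt _ _ hb, if_pos hb, Fin.val_castSucc, add_comm]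
  · rw [Fin.succAbove_of_le_castSucc _ _ (not_lt.1 hb), if_neg, Fin.val_succ,
      show (j : ℕ) + (b + 1 + 1) = b + j + 2 by omega, pow_add _ _ 2]
    · simp
    · simp only [Fin.lt_def, Fin.val_castSucc, Fin.val_succ] at hb ⊢
      omega

theorem diff_diff_eq (n : ℕ) : compHom (n + 2) (n + 1) n (diff k (n + 1)) (diff k n) =
    ∑ q ∈ quads (n + 3), ddTerm k q := by
  simp only [diff, map_sum, LinearMap.sum_apply, map_smul, LinearMap.smul_apply, Finset.smul_sum,
    compHom_dMor]
  rw [← Finset.sum_product']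
  refine Finset.sum_bij (fun x _ => (x.2.1.1, x.2.1.2, x.2.1.2.succAbove x.1.1.1,
    x.2.1.2.succAbove x.1.1.2)) ?_ ?_ ?_ ?_
  · rintro ⟨⟨⟨a, b⟩, h'⟩, ⟨⟨i, j⟩, h⟩⟩ -
    simp only [quads, Finset.mem_filter, Finset.mem_univ, true_and]
    exact ⟨h, (Fin.strictMono_succAbove j).lt_iff_lt.2 h', Fin.succAbove_ne _ _,
      Fin.succAbove_ne _ _⟩
  · rintro ⟨⟨⟨a, b⟩, h'⟩, ⟨⟨i, j⟩, h⟩⟩ - ⟨⟨⟨a', b'⟩, h'₂⟩, ⟨⟨i', j'⟩, h₂⟩⟩ - e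
    simp only [Prod.mk.injEq] at e
    obtain ⟨rfl, rfl, e1, e2⟩ := e
    obtain rfl := Fin.succAbove_right_injective e1
    obtain rfl := Fin.succAbove_right_injective e2
    rfl
  · rintro ⟨i, j, a, b⟩ h
    simp only [quads, Finset.mem_filter, Finset.mem_univ, true_and] at h
    obtain ⟨h1, h2, h3, h4⟩ := h
    obtain ⟨a, rfl⟩ := Fin.exists_succAbove_eq h3
    obtain ⟨b, rfl⟩ := Fin.exists_succAbove_eq h4
    exact ⟨⟨⟨⟨a, b⟩, (Fin.strictMono_succAbove j).lt_iff_lt.1 h2⟩, ⟨⟨i, j⟩, h1⟩⟩,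
      Finset.mem_product.2 ⟨Finset.mem_univ _, Finset.mem_univ _⟩, rfl⟩
  · intro x _
    rfl

theorem skip_comm {n : ℕ} (j b : Fin (n + 3)) (m : Fin (n + 1)) : skip j b m = skip b j m := by
  simp only [skip, min_comm j.1, max_comm j.1]

theorem ddTree_comm {n : ℕ} {i j a b : Fin (n + 3)} (hai : a ≠ i) (hbi : b ≠ i) (haj : a ≠ j) :
    ddTree i j a b = ddTree a b i j := by
  funext m
  simp only [ddTree, skip_comm j b m]
  split_ifs <;> simp_all

theorem ddTerm_swap {n : ℕ} {i j a b : Fin (n + 3)} (hai : a ≠ i) (hbi : b ≠ i) (haj : a ≠ j)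
    (hbj : b ≠ j) : ddTerm k (i, j, a, b) + ddTerm k (a, b, i, j) = 0 := by
  simp only [ddTerm, ddTree_comm hai hbi haj]
  rcases lt_or_gt_of_ne hbj with h | h
  · rw [if_pos h, if_neg h.le.not_gt, ← add_smul, show (b : ℕ) + (j + 1) = j + b + 1 by omega,
      pow_succ]
    simp
  · rw [if_neg h.le.not_gt, if_pos h, ← add_smul, show (j : ℕ) + (b + 1) = b + j + 1 by omega,
      pow_succ]
    simp

theorem exists_skip {n : ℕ} (j b x : Fin (n + 3)) (hx : x < j) (hx' : x < b)
    (hjb : j ≠ b) : ∃ m : Fin (n + 1), ∀ m', skip j b m' = x ↔ m' = m := by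
  have h1 : x.1 < j.1 := hx
  have h2 : x.1 < b.1 := hx'
  have h3 : j.1 ≠ b.1 := fun h => hjb (Fin.ext h)
  refine ⟨⟨x.1, by omega⟩, fun m' => ?_⟩
  simp only [skip, Fin.ext_iff]
  split_ifs <;> simp <;> omega

theorem skip_ne {n : ℕ} (j b : Fin (n + 3)) (hjb : j ≠ b) (m : Fin (n + 1)) :
    skip j b m ≠ j ∧ skip j b m ≠ b := by
  have : j.1 ≠ b.1 := fun h => hjb (Fin.ext h)
  simp only [skip, Ne, Fin.ext_iff]
  split_ifs <;> simp <;> omega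

theorem ddTerm_jac {n : ℕ} {x y z : Fin (n + 3)} (hxy : x < y) (hyz : y < z) :
    ddTerm k (y, z, x, y) + ddTerm k (x, y, x, z) + ddTerm k (x, z, x, y) = 0 := by
  have hxz := hxy.trans hyz
  obtain ⟨m, hm⟩ := exists_skip y z x hxy hxz hyz.ne
  have hm' : ∀ m', skip z y m' = x ↔ m' = m := fun m' => by rw [skip_comm, hm]
  have hF : IsForest (ddTree y z x y) := isForest_ddTree (by
    simp [quads, hyz, hxy, hxz.ne, hyz.ne])
  have key := cls_jac (k := k) (F := ddTree y z x y) (G := ddTree x y x z) (H := ddTree x z x y)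
    hF m (by
      simp only [ddTree, (hm m).2 rfl, (hm' m).2 rfl, if_true, hxy.ne, if_false, hxy.ne',
        hxz.ne']
      exact Jac.node _ _ _)
    (fun i hi => by
      have h1 : skip y z i ≠ x := fun h => hi ((hm i).1 h)
      have h2 := skip_ne y z hyz.ne i
      simp [ddTree, skip_comm z y, h1, h2.1])
    (fun i hi => by
      have h1 : skip y z i ≠ x := fun h => hi ((hm i).1 h)
      have h2 := skip_ne y z hyz.ne i
      simp [ddTree, skip_comm z y, h1, h2.1])
  simp only [ddTerm, if_pos hyz, if_neg hyz.le.not_gt]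
  rw [show (y : ℕ) + (z + 1) = z + y + 1 by omega, pow_succ, ← smul_zero ((-1 : k) ^ (z.1 + y.1)),
    ← key, smul_add, smul_sub, mul_neg_one, sub_eq_add_neg]
  congr 2
  exact neg_smul ((-1 : k) ^ (z.1 + y.1)) (cls (ddTree x y x z))

theorem diff_diff (n : ℕ) : compHom (n + 2) (n + 1) n (diff k (n + 1)) (diff k n) = 0 := by
  rw [diff_diff_eq]
  have hD : ∑ q ∈ (quads (n + 3)).filter (fun q => q.2.2.1 ≠ q.1 ∧ q.2.2.2 ≠ q.1),
      ddTerm k q = 0 := by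
    refine Finset.sum_involution (fun q _ => (q.2.2.1, q.2.2.2, q.1, q.2.1)) ?_ ?_ ?_ ?_
    · rintro ⟨i, j, a, b⟩ h
      simp only [quads, Finset.mem_filter, Finset.mem_univ, true_and] at h
      exact ddTerm_swap h.2.1 h.2.2 h.1.2.2.1 h.1.2.2.2
    · rintro ⟨i, j, a, b⟩ h - e
      simp only [quads, Finset.mem_filter, Finset.mem_univ, true_and, Prod.mk.injEq] at h e
      exact h.2.1 e.1
    · rintro ⟨i, j, a, b⟩ h
      simp only [quads, Finset.mem_filter, Finset.mem_univ, true_and] at h ⊢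
      exact ⟨⟨h.1.2.1, h.1.1, fun e => h.2.2 e.symm, fun e => h.1.2.2.2 e.symm⟩,
        fun e => h.2.1 e.symm, fun e => h.1.2.2.1 e.symm⟩
    · rintro ⟨i, j, a, b⟩ h
      rfl
  have hJ : ∑ q ∈ (quads (n + 3)).filter (fun q => ¬ (q.2.2.1 ≠ q.1 ∧ q.2.2.2 ≠ q.1)),
      ddTerm k q = ∑ t ∈ (Finset.univ.filter fun t : Fin (n + 3) × Fin (n + 3) × Fin (n + 3) =>
        t.1 < t.2.1 ∧ t.2.1 < t.2.2),
      (ddTerm k (t.2.1, t.2.2, t.1, t.2.1) + ddTerm k (t.1, t.2.1, t.1, t.2.2) +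
        ddTerm k (t.1, t.2.2, t.1, t.2.1)) := by
    rw [Finset.sum_add_distrib, Finset.sum_add_distrib, ← Finset.sum_filter_add_sum_filter_not _
      (fun q => q.2.2.2 = q.1)]
    refine Eq.trans ?_ (add_assoc _ _ _).symm
    congr 1
    · refine Finset.sum_bij' (fun q _ => (q.2.2.1, q.1, q.2.1))
        (fun t _ => (t.2.1, t.2.2, t.1, t.2.1)) ?_ ?_ ?_ ?_ ?_
      · rintro ⟨i, j, a, b⟩ h
        simp only [quads, Finset.mem_filter, Finset.mem_univ, true_and, Fin.ext_iff,
          Fin.lt_def, ne_eq] at h ⊢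
        grind
      · rintro ⟨x, y, z⟩ h
        simp only [quads, Finset.mem_filter, Finset.mem_univ, true_and, Fin.ext_iff,
          Fin.lt_def, ne_eq] at h ⊢
        grind
      · rintro ⟨i, j, a, b⟩ h
        simp only [Finset.mem_filter] at h
        simp [h.2]
      · rintro ⟨x, y, z⟩ h
        rfl
      · rintro ⟨i, j, a, b⟩ h
        simp only [Finset.mem_filter] at h
        simp [h.2]
    · rw [← Finset.sum_filter_add_sum_filter_not _ (fun q => q.2.1 < q.2.2.2)]
      congr 1
      · refine Finset.sum_bij' (fun q _ => (q.1, q.2.1, q.2.2.2))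
          (fun t _ => (t.1, t.2.1, t.1, t.2.2)) ?_ ?_ ?_ ?_ ?_
        · rintro ⟨i, j, a, b⟩ h
          simp only [quads, Finset.mem_filter, Finset.mem_univ, true_and, Fin.ext_iff,
            Fin.lt_def, ne_eq] at h ⊢
          grind
        · rintro ⟨x, y, z⟩ h
          simp only [quads, Finset.mem_filter, Finset.mem_univ, true_and, Fin.ext_iff,
            Fin.lt_def, ne_eq] at h ⊢
          grind
        · rintro ⟨i, j, a, b⟩ h
          simp only [quads, Finset.mem_filter, Finset.mem_univ, true_and, Prod.mk.injEq, Fin.ext_iff,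
            Fin.lt_def, ne_eq] at h ⊢
          grind
        · rintro ⟨x, y, z⟩ h
          rfl
        · rintro ⟨i, j, a, b⟩ h
          simp only [quads, Finset.mem_filter, Finset.mem_univ, true_and] at h ⊢
          have : a = i := by omega
          rw [this]
      · refine Finset.sum_bij' (fun q _ => (q.1, q.2.2.2, q.2.1))
          (fun t _ => (t.1, t.2.2, t.1, t.2.1)) ?_ ?_ ?_ ?_ ?_
        · rintro ⟨i, j, a, b⟩ h
          simp only [quads, Finset.mem_filter, Finset.mem_univ, true_and, Fin.ext_iff,
            Fin.lt_def, ne_eq] at h ⊢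
          grind
        · rintro ⟨x, y, z⟩ h
          simp only [quads, Finset.mem_filter, Finset.mem_univ, true_and, Fin.ext_iff,
            Fin.lt_def, ne_eq] at h ⊢
          grind
        · rintro ⟨i, j, a, b⟩ h
          simp only [quads, Finset.mem_filter, Finset.mem_univ, true_and, Prod.mk.injEq, Fin.ext_iff,
            Fin.lt_def, ne_eq] at h ⊢
          grind
        · rintro ⟨x, y, z⟩ h
          rfl
        · rintro ⟨i, j, a, b⟩ h
          simp only [quads, Finset.mem_filter, Finset.mem_univ, true_and] at h ⊢
          have : a = i := by omega
          rw [this]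
  rw [← Finset.sum_filter_add_sum_filter_not (quads (n + 3))
    (fun q => q.2.2.1 ≠ q.1 ∧ q.2.2.2 ≠ q.1), hD, hJ, zero_add]
  refine Finset.sum_eq_zero fun t ht => ?_
  simp only [Finset.mem_filter, Finset.mem_univ, true_and] at ht
  exact ddTerm_jac ht.1 ht.2

open CategoryTheory

/-- `∑_{0 ≤ i < j ≤ n+1} (-1)^j d_{i,j}` as a morphism `[n+1] → [n]` of `Γ_sh^Lie`. -/
def diffMor (k : Type*) [CommRing k] (n : ℕ) :
    GammaShLie.obj (k := k) (n + 1) ⟶ GammaShLie.obj n := diff k n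

theorem diffMor_diffMor (n : ℕ) : diffMor k (n + 1) ≫ diffMor k n = 0 := diff_diff n

universe w u

/-- The Leibniz complex `C^Leib_*(T)` of a linear functor `T` from `Γ_sh^Lie` to `k`-modules:
`C^Leib_n(T) = T([n])` with differential `T(∑_{i<j} (-1)^j d_{i,j})`. -/
def leibnizComplex {k : Type u} [CommRing k] (T : GammaShLie k ⥤ ModuleCat.{w} k) [T.Additive]
    [T.Linear k] : ChainComplex (ModuleCat.{w} k) ℕ :=
  ChainComplex.of (fun n => T.obj (GammaShLie.obj n)) (fun n => T.map (diffMor k n)) fun n => by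
    rw [← T.map_comp, diffMor_diffMor, T.map_zero]

/-- The Leibniz homology `H^Leib_i(T)`. -/
def leibnizHomology {k : Type u} [CommRing k] (T : GammaShLie k ⥤ ModuleCat.{w} k) [T.Additive]
    [T.Linear k] (i : ℕ) : ModuleCat.{w} k :=
  (leibnizComplex T).homology i

/-- The representable functor `P_n = Γ_sh^Lie([n], -)` from `Γ_sh^Lie` to `k`-modules. -/
abbrev projGen (k : Type u) [CommRing k] (n : ℕ) : GammaShLie k ⥤ ModuleCat.{u} k :=
  (linearCoyoneda k (GammaShLie k)).obj (Opposite.op (GammaShLie.obj n))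

instance (k : Type u) [CommRing k] (n : ℕ) : (projGen k n).Linear k where
  map_smul f r := by
    ext x
    exact Linear.comp_smul (R := k) _ _ _ x r f

end

end

end LieSh

/-!
The module `Γ_sh^Lie([n],[m])` is spanned by the shuffling forests: families of `m + 1` trees whose
leaves partition `{0, ..., n}`, ordered by their minima, the first tree containing `0`. For `n ≥ 1`
let `B` be the span of the forests in which the labels `0` and `1` are in different trees (so that
`1` is in the second one), and let `A` be the span of the others. Each `d_{i,j}` maps `A` to `A`,
and each `d_{i,j}` other than `d_{0,1}` maps `B` to `B`, while `d_{0,1}` maps `B` to `A`. Hence the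
Leibniz complex is the cone of `d_{0,1} : B → A`, up to sign, and it suffices that this is an
isomorphism. That is the statement that, for a finite set `S` containing `0` and `1`, the bracket
`⨁ Lie(X) ⊗ Lie(Y) → Lie(S)`, the sum being over `S = X ⊔ Y` with `0 ∈ X` and `1 ∈ Y`, is bijective.

It holds over every commutative ring, without a choice of bases: letting `c` act by
`x ⊗ y ↦ [x,c] ⊗ y + x ⊗ [y,c]` defines an action of `Lie` on the left hand side, and the inverse is
defined by recursion on trees, letting each branch outside the smallest subtree containing `0` and
`1` act on what is found inside. It is the function `sep`, written as a function of a bilinear map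
`β` to be applied to the result. That it respects the relations of `Lie` is `sep_anti` and
`sep_jac`; that it is a right inverse is `sep_mul_eq`, and that it is a left inverse is immediate
from its definition. The resulting map `sepHom : Γ_sh^Lie([n],[m]) → Γ_sh^Lie([n],[m+1])` satisfies
`sepHom (d b) = -b` for `b ∈ B` (`sepHom_compHom_diff`) and `x + d (sepHom x) ∈ B` for all `x`
(`add_compHom_sepHom_mem`), so if `d x = 0`, then `x + d (sepHom x)` is a cycle in `B`, hence zero,
and `x` is a boundary.
-/

namespace LieSh

/-! ### Linear maps out of the morphism modules -/

section

variable {k : Type*} [CommRing k] {A : Type*} {V : Type*} [AddCommGroup V] [Module k V]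

/-- A function on trees that respects antisymmetry and the Jacobi relation at every vertex. -/
structure IsLie (γ : FreeMagma A → V) : Prop where
  anti : ∀ s t, Anti s t → γ s + γ t = 0
  jac : ∀ x y z, Jac x y z → γ x - γ y + γ z = 0

theorem multilinearMap_ext_mk {m : ℕ} {S : Fin m → Set A}
    {Φ Ψ : MultilinearMap k (fun i => LieOp k (S i)) V}
    (h : ∀ (F : Fin m → FreeMagma A) (hF : ∀ i, IsOn (F i) (S i)),
      Φ (fun i => LieOp.mk (F i) (hF i)) = Ψ (fun i => LieOp.mk (F i) (hF i))) : Φ = Ψ := by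
  induction m with
  | zero =>
    ext f
    have e : f = fun i => LieOp.mk (i.elim0 : FreeMagma A) (i.elim0 : IsOn _ (S i)) :=
      Subsingleton.elim _ _
    have := h (fun i => i.elim0) (fun i => i.elim0)
    convert this
  | succ m ih =>
    have : Φ.curryLeft = Ψ.curryLeft := by
      refine LieOp.hom_ext fun t ht => ih fun F hF => ?_
      have e := h (Fin.cons t F) (Fin.cases ht hF)
      have e' : (fun i => LieOp.mk (k := k) ((Fin.cons t F : Fin (m + 1) → FreeMagma A) i)
          (Fin.cases (motive := fun i => IsOn ((Fin.cons t F : Fin (m + 1) → FreeMagma A) i) (S i))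
            ht hF i)) =
          Fin.cons (LieOp.mk t ht) fun i => LieOp.mk (F i) (hF i) := by
        funext i
        cases i using Fin.cases <;> rfl
      rw [e'] at e
      exact e
    rw [← Φ.uncurry_curryLeft, this, Ψ.uncurry_curryLeft]

/-- The tensor product of the `Lie(S i)` is presented by the families of trees on the sets `S i`
modulo the relations of `Lie` in each place. -/
theorem exists_multilinearMap {m : ℕ} (S : Fin m → Set A) (φ : (Fin m → FreeMagma A) → V)
    (hA : ∀ F, (∀ i, IsOn (F i) (S i)) → ∀ l t, Anti (F l) t → φ F + φ (Function.update F l t) = 0)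
    (hJ : ∀ F, (∀ i, IsOn (F i) (S i)) → ∀ l s t, Jac (F l) s t →
      φ F - φ (Function.update F l s) + φ (Function.update F l t) = 0) :
    ∃ Φ : MultilinearMap k (fun i => LieOp k (S i)) V,
      ∀ (F : Fin m → FreeMagma A) (hF : ∀ i, IsOn (F i) (S i)),
        Φ (fun i => LieOp.mk (F i) (hF i)) = φ F := by
  induction m with
  | zero =>
    refine ⟨MultilinearMap.constOfIsEmpty k _ (φ fun i => i.elim0), fun F hF => ?_⟩
    exact congrArg φ (Subsingleton.elim _ _)
  | succ m ih =>
    have key : ∀ t, IsOn t (S 0) → ∃ Φ : MultilinearMap k (fun i : Fin m => LieOp k (S i.succ)) V,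
        ∀ (F : Fin m → FreeMagma A) (hF : ∀ i, IsOn (F i) (S i.succ)),
          Φ (fun i => LieOp.mk (F i) (hF i)) = φ (Fin.cons t F) := fun t ht => by
      refine ih (fun i => S i.succ) (fun F => φ (Fin.cons t F)) ?_ ?_
      · intro F hF l u hu
        simpa only [Fin.cons_update] using
          hA (Fin.cons t F) (Fin.cases ht hF) l.succ u (by simpa using hu)
      · intro F hF l u v hu
        simpa only [Fin.cons_update] using
          hJ (Fin.cons t F) (Fin.cases ht hF) l.succ u v (by simpa using hu)
    choose Φ hΦ using key
    refine ⟨LinearMap.uncurryLeft (LieOp.lift Φ ?_ ?_), ?_⟩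
    · intro s t hs ht h
      refine multilinearMap_ext_mk fun F hF => ?_
      rw [add_apply, hΦ, hΦ, zero_apply]
      simpa only [Fin.update_cons_zero] using hA (Fin.cons s F) (Fin.cases hs hF) 0 t h
    · intro x y z hx hy hz h
      refine multilinearMap_ext_mk fun F hF => ?_
      rw [add_apply, sub_apply, hΦ, hΦ, hΦ,
        zero_apply]
      simpa only [Fin.update_cons_zero] using hJ (Fin.cons x F) (Fin.cases hx hF) 0 y z h
    · intro F hF
      rw [LinearMap.uncurryLeft_apply, LieOp.lift_mk]
      exact (hΦ (F 0) (hF 0) (fun i => F i.succ) fun i => hF i.succ).trans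
        (congrArg φ (Fin.cons_self_tail F))

theorem homMod_ext_cls {n m : ℕ} {φ ψ : HomMod k n m →ₗ[k] V}
    (h : ∀ F, IsForest F → φ (cls F) = ψ (cls F)) : φ = ψ := by
  refine DirectSum.linearMap_ext k fun α => PiTensorProduct.ext ?_
  refine multilinearMap_ext_mk fun F hF => ?_
  have := h F ⟨α, hF⟩
  rwa [← gen_mk F α hF] at this

/-- `Γ_sh^Lie([n],[m])` is presented by the shuffling forests modulo the relations of `Lie` in each
place. -/
theorem exists_linearMap_cls {n m : ℕ} (φ : (Fin (m + 1) → FreeMagma (Fin (n + 1))) → V)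
    (hA : ∀ F, IsForest F → ∀ l t, Anti (F l) t → φ F + φ (Function.update F l t) = 0)
    (hJ : ∀ F, IsForest F → ∀ l s t, Jac (F l) s t →
      φ F - φ (Function.update F l s) + φ (Function.update F l t) = 0) :
    ∃ Φ : HomMod k n m →ₗ[k] V, ∀ F, IsForest F → Φ (cls F) = φ F := by
  have key := fun α : ShMap n m => exists_multilinearMap (k := k) (fun i => α.toFun ⁻¹' {i}) φ
    (fun F hF => hA F ⟨α, hF⟩) (fun F hF => hJ F ⟨α, hF⟩)
  choose Φ hΦ using key
  refine ⟨DirectSum.toModule k _ _ fun α => PiTensorProduct.lift (Φ α), ?_⟩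
  rintro F ⟨α, hF⟩
  rw [← gen_mk F α hF, gen, DirectSum.toModule_lof, PiTensorProduct.lift.tprod, hΦ]

theorem IsForest.update {n m : ℕ} {F : Fin (m + 1) → FreeMagma (Fin (n + 1))} (hF : IsForest F)
    (l : Fin (m + 1)) {t : FreeMagma (Fin (n + 1))} (h : (leaves (F l)).Perm (leaves t)) :
    IsForest (Function.update F l t) := by
  obtain ⟨α, hα⟩ := hF
  refine ⟨α, fun i => ?_⟩
  by_cases hi : i = l
  · subst hi
    rw [Function.update_self]
    exact (hα i).of_perm h
  · rw [Function.update_of_ne hi]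
    exact hα i

theorem cls_of_not_isForest {n m : ℕ} {F : Fin (m + 1) → FreeMagma (Fin (n + 1))}
    (hF : ¬ IsForest F) : (cls F : HomMod k n m) = 0 := by
  rw [cls, dif_neg hF]

theorem cls_anti {n m : ℕ} {F : Fin (m + 1) → FreeMagma (Fin (n + 1))} (hF : IsForest F)
    (l : Fin (m + 1)) {t : FreeMagma (Fin (n + 1))} (h : Anti (F l) t) :
    (cls F + cls (Function.update F l t) : HomMod k n m) = 0 := by
  obtain ⟨α, hα⟩ := hF
  have ht := (hα l).of_perm h.perm
  have hα' : ∀ i, IsOn (Function.update F l t i) (α.toFun ⁻¹' {i}) := fun i => by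
    by_cases hi : i = l
    · subst hi
      rwa [Function.update_self]
    · rw [Function.update_of_ne hi]
      exact hα i
  have e1 : (fun i => LieOp.mk (k := k) (Function.update F l t i) (hα' i)) =
      Function.update (fun i => LieOp.mk (k := k) (F i) (hα i)) l (LieOp.mk t ht) := by
    funext i
    by_cases hi : i = l
    · subst hi; simp
    · simp [Function.update_of_ne hi]
  have e0 := (Function.update_eq_self l (fun i => LieOp.mk (k := k) (F i) (hα i))).symm
  rw [← gen_mk F α hα, ← gen_mk _ α hα', e1, e0, gen, gen, ← map_add]
  simp only [Function.update_idem]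
  rw [← MultilinearMap.map_update_add, LieOp.mk_anti (hα l) ht h, MultilinearMap.map_update_zero,
    map_zero]

/-- The relations hold without assuming that the families are forests: `cls` vanishes on the
families that are not, and the relations preserve the set of leaves of each tree. -/
theorem isLie_cls_update {n m : ℕ} (F : Fin (m + 1) → FreeMagma (Fin (n + 1))) (l : Fin (m + 1)) :
    IsLie fun t => (cls (Function.update F l t) : HomMod k n m) := by
  have upd : ∀ s t : FreeMagma (Fin (n + 1)), (leaves s).Perm (leaves t) →
      IsForest (Function.update F l s) → IsForest (Function.update F l t) := fun s t p h => by
    simpa using h.update l (t := t) (by simpa using p)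
  constructor
  · intro s t h
    by_cases hF : IsForest (Function.update F l s)
    · simpa using cls_anti (k := k) hF l (t := t) (by simpa using h)
    · rw [cls_of_not_isForest hF, cls_of_not_isForest fun h' => hF (upd _ _ h.perm.symm h'),
        add_zero]
  · intro x y z h
    by_cases hF : IsForest (Function.update F l x)
    · refine cls_jac hF l (by simpa using h) ?_ ?_ <;>
      · intro i hi
        simp [Function.update_of_ne hi]
    · rw [cls_of_not_isForest hF, cls_of_not_isForest fun h' => hF (upd _ _ h.perm.1.symm h'),
        cls_of_not_isForest fun h' => hF (upd _ _ h.perm.2.symm h'), sub_zero, add_zero]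

end

end LieSh

namespace LieSh

/-! ### Separating two labels by a bracket -/

section

variable {A V W : Type*} [AddCommGroup V] [AddCommGroup W]

/-- The action of the tree `c` on functions of two trees that is dual to the derivation
`x ⊗ y ↦ [x, c] ⊗ y + x ⊗ [y, c]`. -/
def der (c : FreeMagma A) (β : FreeMagma A → FreeMagma A → V) (x y : FreeMagma A) : V :=
  β (x * c) y + β x (y * c)

theorem IsLie.mul_right {γ : FreeMagma A → V} (h : IsLie γ) (c : FreeMagma A) :
    IsLie fun t => γ (t * c) :=
  ⟨fun _ _ r => h.anti _ _ (r.left c), fun _ _ _ r => h.jac _ _ _ (r.left c)⟩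

theorem IsLie.add {γ γ' : FreeMagma A → V} (h : IsLie γ) (h' : IsLie γ') :
    IsLie fun t => γ t + γ' t :=
  ⟨fun s t r => by rw [add_add_add_comm, h.anti _ _ r, h'.anti _ _ r, add_zero],
    fun x y z r => by
      rw [add_sub_add_comm, add_add_add_comm, h.jac _ _ _ r, h'.jac _ _ _ r, add_zero]⟩

/-- A function of two trees that respects the relations of `Lie` in both arguments. -/
structure IsLie₂ (β : FreeMagma A → FreeMagma A → V) : Prop where
  fst : ∀ y, IsLie fun x => β x y
  snd : ∀ x, IsLie (β x)

theorem IsLie₂.der {β : FreeMagma A → FreeMagma A → V} (h : IsLie₂ β) (c : FreeMagma A) :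
    IsLie₂ (der c β) :=
  ⟨fun y => ((h.fst y).mul_right c).add (h.fst (y * c)),
    fun x => (h.snd (x * c)).add ((h.snd x).mul_right c)⟩

/-- The derivations `der c` make functions of two trees that respect the relations of `Lie` into a
module over the Lie operad. -/
theorem der_jac {β : FreeMagma A → FreeMagma A → V} (hβ : IsLie₂ β) (s t : FreeMagma A) :
    der (s * t) β - der s (der t β) + der t (der s β) = 0 := by
  funext x y
  have e1 := (hβ.fst y).jac _ _ _ (Jac.node x s t)
  have e2 := (hβ.snd x).jac _ _ _ (Jac.node y s t)
  simp only [der, Pi.add_apply, Pi.sub_apply, Pi.zero_apply]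
  rw [← add_zero (0 : V)]
  nth_rw 1 [← e1]
  rw [← e2]
  abel

theorem der_anti {β : FreeMagma A → FreeMagma A → V} (hβ : IsLie₂ β) {s t : FreeMagma A}
    (h : Anti s t) : der s β + der t β = 0 := by
  funext x y
  have e1 := (hβ.fst y).anti _ _ (h.right x)
  have e2 := (hβ.snd x).anti _ _ (h.right y)
  simp only [der, Pi.add_apply, Pi.zero_apply]
  rw [add_add_add_comm, e1, e2, add_zero]

theorem der_jac_jac {β : FreeMagma A → FreeMagma A → V} (hβ : IsLie₂ β) {r s t : FreeMagma A}
    (h : Jac r s t) : der r β - der s β + der t β = 0 := by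
  funext x y
  have e1 := (hβ.fst y).jac _ _ _ (h.right x)
  have e2 := (hβ.snd x).jac _ _ _ (h.right y)
  simp only [der, Pi.add_apply, Pi.sub_apply, Pi.zero_apply]
  rw [add_sub_add_comm, add_add_add_comm, e1, e2, add_zero]

/-- Let `t` be a tree in which the labels `p` and `q` occur once. Pushing the branches outside the
smallest subtree containing `p` and `q` into that subtree, by the derivation property of the
bracket, writes `t` as a sum of brackets `± [x, y]` with `p` in `x` and `q` in `y`; then
`sep p q t β` is the corresponding sum of the `± β x y`. -/
def sep [DecidableEq A] (p q : A) : FreeMagma A → (FreeMagma A → FreeMagma A → V) → V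
  | FreeMagma.of _, _ => 0
  | FreeMagma.mul s t, β =>
    if p ∈ leaves s then
      if q ∈ leaves s then sep p q s (der t β) else β s t
    else
      if q ∈ leaves s then -β t s else -sep p q t (der s β)

variable [DecidableEq A] (p q : A)

theorem sep_mul (s t : FreeMagma A) (β : FreeMagma A → FreeMagma A → V) :
    sep p q (s * t) β =
      if p ∈ leaves s then
        if q ∈ leaves s then sep p q s (der t β) else β s t
      else
        if q ∈ leaves s then -β t s else -sep p q t (der s β) := rfl

theorem sep_map (f : V →+ W) (t : FreeMagma A) (β : FreeMagma A → FreeMagma A → V) :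
    sep p q t (fun x y => f (β x y)) = f (sep p q t β) := by
  induction t generalizing β with
  | ih1 a => exact (map_zero f).symm
  | ih2 s t ihs iht =>
    have h : ∀ c, der c (fun x y => f (β x y)) = fun x y => f (der c β x y) := fun c => by
      funext x y
      exact (map_add f _ _).symm
    simp only [sep_mul, h, ihs, iht]
    split_ifs <;> simp

theorem sep_add (t : FreeMagma A) (β β' : FreeMagma A → FreeMagma A → V) :
    sep p q t (β + β') = sep p q t β + sep p q t β' := by
  induction t generalizing β β' with
  | ih1 a => exact (add_zero _).symm
  | ih2 s t ihs iht =>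
    have h : ∀ c, der c (β + β') = der c β + der c β' := fun c => by
      funext x y
      simp only [der, Pi.add_apply]
      abel
    simp only [sep_mul, h, ihs, iht]
    split_ifs <;> simp <;> abel

theorem sep_neg (t : FreeMagma A) (β : FreeMagma A → FreeMagma A → V) :
    sep p q t (-β) = -sep p q t β :=
  sep_map p q (-AddMonoidHom.id V) t β

theorem sep_sub (t : FreeMagma A) (β β' : FreeMagma A → FreeMagma A → V) :
    sep p q t (β - β') = sep p q t β - sep p q t β' := by
  rw [sub_eq_add_neg, sep_add, sep_neg, sub_eq_add_neg]

theorem sep_zero (t : FreeMagma A) : sep p q t (0 : FreeMagma A → FreeMagma A → V) = 0 := by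
  simpa using sep_sub p q t (0 : FreeMagma A → FreeMagma A → V) 0

variable {p q}

/-- The value of `sep p q t β` depends only on the `β x y` such that `x` contains `p`, `y` contains
`q` and `x` and `y` together have the same leaves as `t`. -/
theorem sep_congr {t : FreeMagma A} (hp : p ∈ leaves t) (hq : q ∈ leaves t)
    {β β' : FreeMagma A → FreeMagma A → V}
    (h : ∀ x y, p ∈ leaves x → q ∈ leaves y → (leaves (x * y)).Perm (leaves t) →
      β x y = β' x y) : sep p q t β = sep p q t β' := by
  induction t generalizing β β' with
  | ih1 a => rfl
  | ih2 s t ihs iht =>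
    have e1 : ∀ (c : FreeMagma A) (x y : FreeMagma A),
        (leaves (x * c * y)).Perm (leaves (x * y * c)) := fun c x y => by
      simp only [leaves_mul, List.append_assoc]
      exact List.perm_append_comm.append_left _
    have e2 : ∀ (c : FreeMagma A) (x y : FreeMagma A),
        (leaves (x * (y * c))).Perm (leaves (x * y * c)) := fun c x y => by
      simp only [leaves_mul, List.append_assoc]
      exact List.Perm.refl _
    have hd : ∀ c d : FreeMagma A, (leaves (d * c)).Perm (leaves (s * t)) → ∀ x y,
        p ∈ leaves x → q ∈ leaves y → (leaves (x * y)).Perm (leaves d) →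
        der c β x y = der c β' x y := fun c d hcd x y hx hy hxy => by
      have e3 : (leaves (x * y * c)).Perm (leaves (s * t)) :=
        (hxy.append_right (leaves c)).trans hcd
      simp only [der]
      rw [h (x * c) y (by simp [hx]) hy ((e1 c x y).trans e3),
        h x (y * c) hx (by simp [hy]) ((e2 c x y).trans e3)]
    simp only [leaves_mul, List.mem_append] at hp hq
    simp only [sep_mul]
    split_ifs with h1 h2 h2
    · exact ihs h1 h2 (hd t s (List.Perm.refl _))
    · exact h s t h1 (hq.resolve_left h2) (List.Perm.refl _)
    · rw [h t s (hp.resolve_left h1) h2 List.perm_append_comm]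
    · rw [iht (hp.resolve_left h1) (hq.resolve_left h2) (hd s t List.perm_append_comm)]

/-- The expansion of `t` as a sum of brackets `± [x, y]` is an identity in `Lie`. -/
theorem sep_mul_eq {γ : FreeMagma A → V} (hγ : IsLie γ) {t : FreeMagma A} (hp : p ∈ leaves t)
    (hq : q ∈ leaves t) (hpq : p ≠ q) : sep p q t (fun x y => γ (x * y)) = γ t := by
  induction t generalizing γ with
  | ih1 a =>
    simp only [leaves_of, List.mem_singleton] at hp hq
    exact absurd (hp.trans hq.symm) hpq
  | ih2 s t ihs iht =>
    have hd : ∀ c, der c (fun x y => γ (x * y)) = fun x y => γ (x * y * c) := fun c => by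
      funext x y
      have := hγ.jac _ _ _ (Jac.node x y c)
      simp only [der]
      rw [← sub_eq_zero, ← this]
      abel
    have hs : γ (s * t) = -γ (t * s) := eq_neg_of_add_eq_zero_left (hγ.anti _ _ (Anti.swap s t))
    simp only [leaves_mul, List.mem_append] at hp hq
    simp only [sep_mul, hd]
    split_ifs with h1 h2 h2
    · exact ihs (hγ.mul_right t) h1 h2
    · rfl
    · exact hs.symm
    · rw [iht (hγ.mul_right s) (hp.resolve_left h1) (hq.resolve_left h2), hs]

theorem sep_anti {s t : FreeMagma A} (h : Anti s t) (hs : (leaves s).Nodup) (hp : p ∈ leaves s)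
    (hq : q ∈ leaves s) {β : FreeMagma A → FreeMagma A → V} (hβ : IsLie₂ β) :
    sep p q s β + sep p q t β = 0 := by
  induction h generalizing β with
  | swap s t =>
    have hd := List.disjoint_of_nodup_append hs
    have hp' : p ∈ leaves s → p ∉ leaves t := fun h h' => hd h h'
    have hq' : q ∈ leaves s → q ∉ leaves t := fun h h' => hd h h'
    simp only [leaves_mul, List.mem_append] at hp hq
    simp only [sep_mul]
    split_ifs <;> simp_all
  | @left s s' t h ih =>
    have hn := (List.nodup_append'.1 hs).1
    simp only [leaves_mul, List.mem_append] at hp hq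
    simp only [sep_mul, ← h.perm.mem_iff]
    split_ifs with h1 h2 h2
    · exact ih hn h1 h2 (hβ.der t)
    · exact (hβ.fst t).anti _ _ h
    · rw [← neg_add, (hβ.snd t).anti _ _ h, neg_zero]
    · rw [← neg_add, ← sep_add, der_anti hβ h, sep_zero, neg_zero]
  | @right t s s' h ih =>
    have hn := (List.nodup_append'.1 hs).2.1
    simp only [leaves_mul, List.mem_append] at hp hq
    simp only [sep_mul]
    split_ifs with h1 h2 h2
    · rw [← sep_add, der_anti hβ h, sep_zero]
    · exact (hβ.snd t).anti _ _ h
    · rw [← neg_add, (hβ.fst t).anti _ _ h, neg_zero]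
    · rw [← neg_add, ih hn (hp.resolve_left h1) (hq.resolve_left h2) (hβ.der t), neg_zero]

theorem sep_jac_node {r s t : FreeMagma A} (hn : (leaves (r * (s * t))).Nodup)
    (hp : p ∈ leaves (r * (s * t))) (hq : q ∈ leaves (r * (s * t)))
    {β : FreeMagma A → FreeMagma A → V} (hβ : IsLie₂ β) :
    sep p q (r * (s * t)) β - sep p q (r * s * t) β + sep p q (r * t * s) β = 0 := by
  have h1 := List.nodup_append'.1 hn
  have h2 := List.nodup_append'.1 h1.2.1
  have hr : ∀ a, a ∈ leaves r → a ∉ leaves s ∧ a ∉ leaves t := fun a ha =>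
    ⟨fun h => h1.2.2 ha (List.mem_append_left _ h), fun h => h1.2.2 ha (List.mem_append_right _ h)⟩
  have hs : ∀ a, a ∈ leaves s → a ∉ leaves r ∧ a ∉ leaves t := fun a ha =>
    ⟨fun h => (hr a h).1 ha, fun h => h2.2.2 ha h⟩
  have ht : ∀ a, a ∈ leaves t → a ∉ leaves r ∧ a ∉ leaves s := fun a ha =>
    ⟨fun h => (hr a h).2 ha, fun h => h2.2.2 h ha⟩
  have af : ∀ y u v, β (u * v) y + β (v * u) y = 0 :=
    fun y u v => (hβ.fst y).anti _ _ (Anti.swap u v)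
  have as : ∀ y u v, β y (u * v) + β y (v * u) = 0 :=
    fun y u v => (hβ.snd y).anti _ _ (Anti.swap u v)
  simp only [leaves_mul, List.mem_append] at hp hq
  -- the nine cases of the positions of `p` and `q` among `r`, `s`, `t`
  rcases hp with hp | hp | hp <;> rcases hq with hq | hq | hq
  · simp only [sep_mul, leaves_mul, List.mem_append, hp, hq, if_true, true_or]
    rw [← sep_sub, ← sep_add, der_jac hβ, sep_zero]
  · simp only [sep_mul, leaves_mul, List.mem_append, hp, hq, hr _ hp, hs _ hq, if_true, if_false,
      or_true, or_false, der]
    abel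
  · simp only [sep_mul, leaves_mul, List.mem_append, hp, hq, hr _ hp, ht _ hq, if_true, if_false,
      or_true, or_false, der]
    have := as r s t
    rw [← this]
    abel
  · simp only [sep_mul, leaves_mul, List.mem_append, hp, hq, hs _ hp, hr _ hq, if_true, if_false,
      or_true, or_false, der]
    abel
  · simp only [sep_mul, leaves_mul, List.mem_append, hp, hq, hs _ hp, hs _ hq, if_true, if_false,
      or_true, or_false]
    have := congrArg (sep p q s) (der_jac hβ r t)
    rw [sep_add, sep_sub, sep_zero] at this
    rw [← neg_eq_zero, ← this]
    abel
  · simp only [sep_mul, leaves_mul, List.mem_append, hp, hq, hs _ hp, ht _ hq, if_true, if_false,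
      or_true, or_false, der]
    have e1 := af t r s
    have e2 := as s r t
    rw [← neg_eq_zero, ← add_zero (0 : V)]
    nth_rw 1 [← e1]
    rw [← e2]
    abel
  · simp only [sep_mul, leaves_mul, List.mem_append, hp, hq, ht _ hp, hr _ hq, if_true, if_false,
      or_true, or_false, der]
    have := af r s t
    rw [← neg_eq_zero, ← this]
    abel
  · simp only [sep_mul, leaves_mul, List.mem_append, hp, hq, ht _ hp, hs _ hq, if_true, if_false,
      or_true, or_false, der]
    have e1 := af s r t
    have e2 := as t r s
    rw [← add_zero (0 : V)]
    nth_rw 1 [← e1]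
    rw [← e2]
    abel
  · simp only [sep_mul, leaves_mul, List.mem_append, hp, hq, ht _ hp, ht _ hq, if_true, if_false,
      or_true, or_false]
    have := congrArg (sep p q t) (der_jac hβ r s)
    rw [sep_add, sep_sub, sep_zero] at this
    rw [← this]
    abel

theorem sep_jac {x y z : FreeMagma A} (h : Jac x y z) (hx : (leaves x).Nodup) (hp : p ∈ leaves x)
    (hq : q ∈ leaves x) {β : FreeMagma A → FreeMagma A → V} (hβ : IsLie₂ β) :
    sep p q x β - sep p q y β + sep p q z β = 0 := by
  induction h generalizing β with
  | node r s t => exact sep_jac_node hx hp hq hβ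
  | @left x y z t h ih =>
    have hn := (List.nodup_append'.1 hx).1
    simp only [leaves_mul, List.mem_append] at hp hq
    simp only [sep_mul, ← h.perm.1.mem_iff, ← h.perm.2.mem_iff]
    split_ifs with h1 h2 h2
    · exact ih hn h1 h2 (hβ.der t)
    · exact (hβ.fst t).jac _ _ _ h
    · rw [← neg_eq_zero, ← (hβ.snd t).jac _ _ _ h]
      abel
    · have e := congrArg (sep p q t) (der_jac_jac hβ h)
      rw [sep_add, sep_sub, sep_zero] at e
      rw [← neg_eq_zero, ← e]
      abel
  | @right t x y z h ih =>
    have hn := (List.nodup_append'.1 hx).2.1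
    simp only [leaves_mul, List.mem_append] at hp hq
    simp only [sep_mul]
    split_ifs with h1 h2 h2
    · rw [← sep_sub, ← sep_add, der_jac_jac hβ h, sep_zero]
    · exact (hβ.snd t).jac _ _ _ h
    · rw [← neg_eq_zero, ← (hβ.fst t).jac _ _ _ h]
      abel
    · rw [← neg_eq_zero, ← ih hn (hp.resolve_left h1) (hq.resolve_left h2) (hβ.der t)]
      abel

end

end LieSh

namespace LieSh

noncomputable section

/-! ### Moving the label `1` out of the block of `0` -/

section

variable {k : Type*} [CommRing k] {n m : ℕ}

theorem IsForest.zero_mem {F : Fin (m + 1) → FreeMagma (Fin (n + 1))} (hF : IsForest F) :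
    0 ∈ leaves (F 0) := by
  obtain ⟨α, hα⟩ := hF
  exact ((hα 0).mem_iff 0).2 α.map_zero

theorem IsForest.nodup {F : Fin (m + 1) → FreeMagma (Fin (n + 1))} (hF : IsForest F)
    (l : Fin (m + 1)) : (leaves (F l)).Nodup := by
  obtain ⟨α, hα⟩ := hF
  exact (hα l).nodup

/-- If the label `1` is not in the block of `0`, then it is the minimum of its block, which is
therefore the next one. -/
theorem IsForest.eq_one_of_mem {F : Fin (m + 2) → FreeMagma (Fin (n + 2))} (hF : IsForest F)
    (h0 : 1 ∉ leaves (F 0)) {l : Fin (m + 2)} (h : 1 ∈ leaves (F l)) : l = 1 := by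
  obtain ⟨α, hα⟩ := hF
  have hl : α.toFun 1 = l := ((hα l).mem_iff 1).1 h
  have hl0 : l ≠ 0 := by
    rintro rfl
    exact h0 h
  by_contra hl1
  have hlt : 1 < α.toFun 1 := by
    rw [hl, Fin.lt_def, Fin.val_one]
    have h2 : l.1 ≠ 0 := fun e => hl0 (Fin.ext e)
    have h3 : l.1 ≠ 1 := fun e => hl1 (Fin.ext e)
    omega
  obtain ⟨x, hx, hx1⟩ := α.exists_lt 1 1 hlt
  have hx0 : x = 0 := by
    rw [Fin.lt_def, Fin.val_one] at hx1
    exact Fin.ext (Nat.lt_one_iff.1 hx1)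
  rw [hx0, α.map_zero] at hx
  exact absurd hx (by simp)

/-- If the tree at the block of `0` is replaced by two trees, the first one containing `0` and the
second one containing `1`, then the blocks are still ordered by their minima. -/
theorem IsForest.cons_cons {F : Fin (m + 1) → FreeMagma (Fin (n + 2))} (hF : IsForest F)
    {a b : FreeMagma (Fin (n + 2))} (ha : 0 ∈ leaves a) (hb : 1 ∈ leaves b)
    (h : (leaves (a * b)).Perm (leaves (F 0))) :
    IsForest (Fin.cons a (Fin.cons b (Fin.tail F)) : Fin (m + 2) → FreeMagma (Fin (n + 2))) := by
  classical
  obtain ⟨α, hα⟩ := hF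
  have hab : IsOn (a * b) (α.toFun ⁻¹' {0}) := (hα 0).of_perm h.symm
  have hmem : ∀ x, α.toFun x = 0 ↔ x ∈ leaves a ∨ x ∈ leaves b := fun x => by
    simpa using (hab.mem_iff x).symm
  have hdisj : ∀ x, x ∈ leaves a → x ∉ leaves b := fun x h1 h2 =>
    Set.disjoint_left.1 hab.disj h1 h2
  let f : Fin (n + 2) → Fin (m + 2) := fun x =>
    if x ∈ leaves a then 0 else (α.toFun x).succ
  have f0 : ∀ x, f x = 0 ↔ x ∈ leaves a := fun x => by
    simp only [f]
    split_ifs with hx <;> simp [hx, Fin.succ_ne_zero]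
  have f1 : ∀ x (l : Fin (m + 1)), f x = l.succ ↔ x ∉ leaves a ∧ α.toFun x = l := fun x l => by
    simp only [f]
    split_ifs with hx
    · simp [hx, (Fin.succ_ne_zero l).symm]
    · simp [hx]
  have fz : f 0 = 0 := (f0 0).2 ha
  have fo : f 1 = (0 : Fin (m + 1)).succ :=
    (f1 1 0).2 ⟨fun h1 => hdisj 1 h1 hb, (hmem 1).2 (Or.inr hb)⟩
  have fs : ∀ x (l : Fin m), α.toFun x = l.succ → f x = l.succ.succ := fun x l hx =>
    (f1 x _).2 ⟨fun h1 => Fin.succ_ne_zero l (hx.symm.trans ((hmem x).2 (Or.inl h1))), hx⟩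
  have hsurj : Function.Surjective f := by
    intro l
    induction l using Fin.cases with
    | zero => exact ⟨0, fz⟩
    | succ l =>
      induction l using Fin.cases with
      | zero => exact ⟨1, fo⟩
      | succ l =>
        obtain ⟨x, hx⟩ := α.surj l.succ
        exact ⟨x, fs x l hx⟩
  have hsh : ∀ i y, i < f y → ∃ x, f x = i ∧ x < y := by
    intro i y hi
    have hy0 : y ≠ 0 := by
      rintro rfl
      rw [fz] at hi
      exact absurd hi (Fin.not_lt_zero i)
    induction i using Fin.cases with
    | zero => exact ⟨0, fz, Fin.pos_of_ne_zero hy0⟩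
    | succ i =>
      induction i using Fin.cases with
      | zero =>
        have hy1 : y ≠ 1 := by
          rintro rfl
          rw [fo] at hi
          exact lt_irrefl _ hi
        refine ⟨1, fo, ?_⟩
        have h2 : y.1 ≠ 0 := fun e => hy0 (Fin.ext e)
        have h3 : y.1 ≠ 1 := fun e => hy1 (Fin.ext e)
        rw [Fin.lt_def, Fin.val_one]
        omega
      | succ i =>
        have hya : y ∉ leaves a := fun hy => by
          rw [(f0 y).2 hy] at hi
          exact absurd hi (Fin.not_lt_zero _)
        rw [(f1 y (α.toFun y)).2 ⟨hya, rfl⟩, Fin.succ_lt_succ_iff] at hi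
        obtain ⟨x, hx, hxy⟩ := α.exists_lt _ _ hi
        exact ⟨x, fs x i hx, hxy⟩
  refine ⟨⟨f, fz, hsurj, shuffle_of hsurj hsh⟩, fun l => ?_⟩
  induction l using Fin.cases with
  | zero => exact ⟨hab.left.nodup, fun x => (f0 x).symm⟩
  | succ l =>
    induction l using Fin.cases with
    | zero =>
      refine ⟨hab.right.nodup, fun x => Iff.trans ?_ (f1 x 0).symm⟩
      rw [hmem]
      exact ⟨fun hx => ⟨fun h1 => hdisj x h1 hx, Or.inr hx⟩, fun hx => hx.2.resolve_left hx.1⟩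
    | succ l =>
      refine ⟨(hα l.succ).nodup, fun x => ((hα l.succ).mem_iff x).trans ⟨fs x l, fun hx => ?_⟩⟩
      exact ((f1 x l.succ).1 hx).2

/-- The generator given by the trees `a`, `b` and the family `R`, as a function of `a` and `b`;
it is zero if these do not form a forest. -/
def pairCls (k : Type*) [CommRing k] (R : Fin m → FreeMagma (Fin (n + 1)))
    (a b : FreeMagma (Fin (n + 1))) : HomMod k n (m + 1) :=
  cls (Fin.cons a (Fin.cons b R) : Fin (m + 2) → FreeMagma (Fin (n + 1)))

theorem isLie₂_pairCls (R : Fin m → FreeMagma (Fin (n + 1))) : IsLie₂ (pairCls k R) := by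
  constructor
  · intro b
    simpa only [pairCls, Fin.update_cons_zero] using
      isLie_cls_update (k := k) (Fin.cons b (Fin.cons b R)) 0
  · intro a
    have := isLie_cls_update (k := k) (Fin.cons a (Fin.cons a R)) (Fin.succ 0)
    simp only [← Fin.cons_update, Fin.update_cons_zero] at this
    exact this

theorem isLie_pairCls_update (R : Fin m → FreeMagma (Fin (n + 1))) (i : Fin m) :
    IsLie fun t => pairCls k (Function.update R i t) := by
  have key := fun a b => isLie_cls_update (k := k) (Fin.cons a (Fin.cons b R)) i.succ.succ
  simp only [← Fin.cons_update] at key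
  exact ⟨fun s t h => funext₂ fun a b => (key a b).anti s t h,
    fun x y z h => funext₂ fun a b => (key a b).jac x y z h⟩

/-- If the first tree of the forest `F` contains `1`, write it as a sum of brackets `± [a, b]` with
`0` in `a` and `1` in `b`, and replace each bracket by the two trees `a` and `b`. -/
def sepForest (k : Type*) [CommRing k] (F : Fin (m + 1) → FreeMagma (Fin (n + 2))) :
    HomMod k (n + 1) (m + 1) :=
  if 1 ∈ leaves (F 0) then sep 0 1 (F 0) (pairCls k (Fin.tail F)) else 0

theorem sepForest_anti {F : Fin (m + 1) → FreeMagma (Fin (n + 2))} (hF : IsForest F)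
    (l : Fin (m + 1)) {t : FreeMagma (Fin (n + 2))} (h : Anti (F l) t) :
    sepForest k F + sepForest k (Function.update F l t) = 0 := by
  induction l using Fin.cases with
  | zero =>
    simp only [sepForest, Function.update_self, Fin.tail_update_zero, ← h.perm.mem_iff]
    split_ifs with h1
    · exact sep_anti h (hF.nodup 0) hF.zero_mem h1 (isLie₂_pairCls _)
    · exact add_zero 0
  | succ i =>
    have e0 : Function.update (Fin.tail F) i (F i.succ) = Fin.tail F :=
      Function.update_eq_self i (Fin.tail F)
    simp only [sepForest, Fin.tail_update_succ,
      Function.update_of_ne (Fin.succ_ne_zero i).symm]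
    split_ifs
    · have e := congrArg (sep 0 1 (F 0)) ((isLie_pairCls_update (k := k) (Fin.tail F) i).anti _ _ h)
      rwa [sep_add, sep_zero, e0] at e
    · exact add_zero 0

theorem sepForest_jac {F : Fin (m + 1) → FreeMagma (Fin (n + 2))} (hF : IsForest F)
    (l : Fin (m + 1)) {s t : FreeMagma (Fin (n + 2))} (h : Jac (F l) s t) :
    sepForest k F - sepForest k (Function.update F l s) +
      sepForest k (Function.update F l t) = 0 := by
  induction l using Fin.cases with
  | zero =>
    simp only [sepForest, Function.update_self, Fin.tail_update_zero, ← h.perm.1.mem_iff,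
      ← h.perm.2.mem_iff]
    split_ifs with h1
    · exact sep_jac h (hF.nodup 0) hF.zero_mem h1 (isLie₂_pairCls _)
    · simp
  | succ i =>
    have e0 : Function.update (Fin.tail F) i (F i.succ) = Fin.tail F :=
      Function.update_eq_self i (Fin.tail F)
    simp only [sepForest, Fin.tail_update_succ,
      Function.update_of_ne (Fin.succ_ne_zero i).symm]
    split_ifs
    · have e := congrArg (sep 0 1 (F 0))
        ((isLie_pairCls_update (k := k) (Fin.tail F) i).jac _ _ _ h)
      rwa [sep_add, sep_sub, sep_zero, e0] at e
    · simp

theorem exists_sepHom (k : Type*) [CommRing k] (n m : ℕ) :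
    ∃ Ψ : HomMod k (n + 1) m →ₗ[k] HomMod k (n + 1) (m + 1),
      ∀ F, IsForest F → Ψ (cls F) = sepForest k F :=
  exists_linearMap_cls (sepForest k) (fun _ hF l _ h => sepForest_anti hF l h)
    fun _ hF l _ _ h => sepForest_jac hF l h

/-- The linear map `Γ_sh^Lie([n+1],[m]) → Γ_sh^Lie([n+1],[m+1])` given by `sepForest`. -/
def sepHom (k : Type*) [CommRing k] (n m : ℕ) :
    HomMod k (n + 1) m →ₗ[k] HomMod k (n + 1) (m + 1) :=
  (exists_sepHom k n m).choose

theorem sepHom_cls {F : Fin (m + 1) → FreeMagma (Fin (n + 2))} (hF : IsForest F) :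
    sepHom k n m (cls F) = sepForest k F :=
  (exists_sepHom k n m).choose_spec F hF

/-- The span of the forests in which `0` and `1` are in different trees. -/
def sepSpan (k : Type*) [CommRing k] (n m : ℕ) : Submodule k (HomMod k (n + 1) m) :=
  Submodule.span k {x | ∃ F, IsForest F ∧ 1 ∉ leaves (F 0) ∧ x = cls F}

theorem sepHom_of_mem {x : HomMod k (n + 1) m} (hx : x ∈ sepSpan k n m) :
    sepHom k n m x = 0 := by
  have : sepSpan k n m ≤ LinearMap.ker (sepHom k n m) := by
    refine Submodule.span_le.2 ?_
    rintro _ ⟨F, hF, h, rfl⟩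
    rw [SetLike.mem_coe, LinearMap.mem_ker, sepHom_cls hF, sepForest, if_neg h]
  exact this hx

theorem lift_dTree_apply {B : Type*} (G : Fin (m + 2) → FreeMagma B) (i j : Fin (m + 2))
    (l : Fin (m + 1)) : FreeMagma.lift G (dTree i j l) =
      if j.succAbove l = i then G i * G j else G (j.succAbove l) := by
  unfold dTree
  split_ifs <;> simp

theorem lift_dTree_zero_one {B : Type*} (G : Fin (m + 2) → FreeMagma B) :
    (fun l => FreeMagma.lift G (dTree 0 1 l)) =
      Fin.cons (G 0 * G 1) (Fin.tail (Fin.tail G)) := by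
  funext l
  rw [lift_dTree_apply]
  induction l using Fin.cases with
  | zero => simp
  | succ l =>
    have : (1 : Fin (m + 2)).succAbove l.succ = l.succ.succ :=
      Fin.succAbove_of_lt_succ _ _ (by simp [Fin.lt_def])
    rw [this, if_neg (Fin.succ_ne_zero _)]
    rfl

/-- On a forest in which `0` and `1` are in different trees, all summands of the differential but
`-d_{0,1}` leave `0` and `1` in different trees. -/
theorem exists_compHom_diff {G : Fin (m + 2) → FreeMagma (Fin (n + 2))} (hG : IsForest G)
    (h1 : 1 ∉ leaves (G 0)) : ∃ r ∈ sepSpan k n m,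
      compHom (n + 1) (m + 1) m (cls G) (diff k m) =
        r - cls (Fin.cons (G 0 * G 1) (Fin.tail (Fin.tail G)) :
          Fin (m + 1) → FreeMagma (Fin (n + 2))) := by
  have hlt : (0 : Fin (m + 2)) < 1 := by simp
  let q₀ : {q : Fin (m + 2) × Fin (m + 2) // q.1 < q.2} := ⟨(0, 1), hlt⟩
  have hq : ∀ q : {q : Fin (m + 2) × Fin (m + 2) // q.1 < q.2},
      compHom (n + 1) (m + 1) m (cls G) (dMor q.1.1 q.1.2 q.2) =
        (cls fun l => FreeMagma.lift G (dTree q.1.1 q.1.2 l) : HomMod k (n + 1) m) := fun q => by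
    rw [dMor_eq, compHom_cls hG (isForest_dTree _ _ q.2)]
  simp only [diff, map_sum, map_smul, hq]
  rw [← Finset.sum_erase_add _ _ (Finset.mem_univ q₀)]
  refine ⟨∑ q ∈ Finset.univ.erase q₀, (-1 : k) ^ (q.1.2 : ℕ) •
    cls fun l => FreeMagma.lift G (dTree q.1.1 q.1.2 l), ?_, ?_⟩
  rotate_left
  · rw [sub_eq_add_neg]
    congr 1
    simp only [q₀, lift_dTree_zero_one, Fin.val_one, pow_one]
    exact neg_one_smul k (cls _ : HomMod k (n + 1) m)
  · refine Submodule.sum_mem _ fun q hq' => Submodule.smul_mem _ _ (Submodule.subset_span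
      ⟨_, isForest_lift hG (isForest_dTree _ _ q.2), ?_, rfl⟩)
    obtain ⟨⟨i, j⟩, hij⟩ := q
    have hij' : i < j := hij
    have hj0 : j ≠ 0 := ((Fin.zero_le i).trans_lt hij').ne'
    simp only [lift_dTree_apply, Fin.succAbove_ne_zero_zero hj0]
    split_ifs with hi
    · subst hi
      rw [leaves_mul, List.mem_append, not_or]
      refine ⟨h1, fun hj => (Finset.mem_erase.1 hq').1 ?_⟩
      exact Subtype.ext (Prod.ext rfl (hG.eq_one_of_mem h1 hj))
    · exact h1

theorem IsForest.one_mem {G : Fin (m + 2) → FreeMagma (Fin (n + 2))} (hG : IsForest G)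
    (h1 : 1 ∉ leaves (G 0)) : 1 ∈ leaves (G 1) := by
  have ⟨α, hα⟩ := hG
  have h := ((hα (α.toFun 1)).mem_iff 1).2 rfl
  rwa [hG.eq_one_of_mem h1 h] at h

theorem isForest_join {G : Fin (m + 2) → FreeMagma (Fin (n + 2))} (hG : IsForest G) :
    IsForest (Fin.cons (G 0 * G 1) (Fin.tail (Fin.tail G)) :
      Fin (m + 1) → FreeMagma (Fin (n + 2))) := by
  have := isForest_lift hG (isForest_dTree (0 : Fin (m + 2)) 1 (by simp))
  rwa [lift_dTree_zero_one] at this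

/-- Up to sign, `sepHom` is inverse to `d_{0,1}` from forests with `0` and `1` in different trees to
forests with `0` and `1` in the same tree; here, that it is a left inverse. -/
theorem sepHom_compHom_diff {x : HomMod k (n + 1) (m + 1)} (hx : x ∈ sepSpan k n (m + 1)) :
    sepHom k n m (compHom (n + 1) (m + 1) m x (diff k m)) = -x := by
  refine Submodule.span_induction ?_ (by simp) ?_ ?_ hx
  · rintro _ ⟨G, hG, h1, rfl⟩
    obtain ⟨r, hr, e⟩ := exists_compHom_diff (k := k) hG h1
    rw [e, map_sub, sepHom_of_mem hr, zero_sub, sepHom_cls (isForest_join hG), sepForest, if_pos]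
    · simp only [Fin.cons_zero, Fin.tail_cons]
      rw [sep_mul, if_pos hG.zero_mem, if_neg h1, pairCls]
      congr 2
      have e' : Fin.cons (G 1) (Fin.tail (Fin.tail G)) = Fin.tail G :=
        Fin.cons_self_tail (Fin.tail G)
      rw [e', Fin.cons_self_tail]
    · simp [hG.one_mem h1]
  · intro x y _ _ hx hy
    rw [map_add, LinearMap.add_apply, map_add, hx, hy, neg_add]
  · intro c x _ hx
    rw [map_smul, LinearMap.smul_apply, map_smul, hx, smul_neg]

/-- Up to sign, `sepHom` is inverse to `d_{0,1}` from forests with `0` and `1` in different trees to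
forests with `0` and `1` in the same tree; here, that it is a right inverse. -/
theorem add_compHom_sepHom_mem (x : HomMod k (n + 1) m) :
    x + compHom (n + 1) (m + 1) m (sepHom k n m x) (diff k m) ∈ sepSpan k n m := by
  let f : HomMod k (n + 1) (m + 1) →ₗ[k] HomMod k (n + 1) m ⧸ sepSpan k n m :=
    (sepSpan k n m).mkQ ∘ₗ (compHom (n + 1) (m + 1) m).flip (diff k m)
  have key : (sepSpan k n m).mkQ + f ∘ₗ sepHom k n m = 0 := by
    refine homMod_ext_cls fun F hF => ?_
    rw [LinearMap.add_apply, LinearMap.comp_apply, sepHom_cls hF, LinearMap.zero_apply, sepForest]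
    split_ifs with h1
    · have hγ : IsLie fun t => (cls (Fin.cons t (Fin.tail F)) : HomMod k (n + 1) m) := by
        simpa only [Fin.update_cons_zero] using
          isLie_cls_update (k := k) (Fin.cons (F 0) (Fin.tail F)) 0
      have e := sep_mul_eq hγ hF.zero_mem h1 (by simp)
      have e' : f (sep 0 1 (F 0) (pairCls k (Fin.tail F))) =
          -(sepSpan k n m).mkQ (sep 0 1 (F 0)
            fun a b => (cls (Fin.cons (a * b) (Fin.tail F)) : HomMod k (n + 1) m)) := by
        rw [← LinearMap.neg_apply]
        refine (sep_map 0 1 f.toAddMonoidHom (F 0) _).symm.trans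
          (Eq.trans ?_ (sep_map 0 1 (-(sepSpan k n m).mkQ).toAddMonoidHom (F 0) _))
        refine sep_congr hF.zero_mem h1 fun a b ha hb hab => ?_
        have hG := hF.cons_cons ha hb hab
        have hn : 1 ∉ leaves a := fun h =>
          (List.nodup_append'.1 (hab.nodup_iff.2 (hF.nodup 0))).2.2 h hb
        obtain ⟨r, hr, e⟩ := exists_compHom_diff (k := k) hG hn
        have hr' : (sepSpan k n m).mkQ r = 0 := (Submodule.Quotient.mk_eq_zero _).2 hr
        refine (congrArg (sepSpan k n m).mkQ e).trans ?_
        rw [map_sub, hr', zero_sub]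
        rfl
      rw [e', e, ← sub_eq_add_neg, sub_eq_zero]
      exact congrArg (fun F => (sepSpan k n m).mkQ (cls F)) (Fin.cons_self_tail F).symm
    · rw [map_zero, add_zero]
      exact (Submodule.Quotient.mk_eq_zero _).2 (Submodule.subset_span ⟨F, hF, h1, rfl⟩)
  exact (Submodule.Quotient.mk_eq_zero _).1 (LinearMap.congr_fun key x)

/-- Exactness of the Leibniz complex of `P_n` in positive degrees. -/
theorem exists_compHom_diff_eq (n : ℕ) {m : ℕ} (x : HomMod k n (m + 1))
    (hx : compHom n (m + 1) m x (diff k m) = 0) :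
    ∃ y : HomMod k n (m + 2), compHom n (m + 2) (m + 1) y (diff k (m + 1)) = x := by
  cases n with
  | zero =>
    -- there is no surjection from `[0]` to `[m + 1]`
    have : IsEmpty (ShMap 0 (m + 1)) := ⟨fun α => by
      have := Fintype.card_le_of_surjective _ α.surj
      simp at this⟩
    exact ⟨0, DFinsupp.ext fun α => isEmptyElim α⟩
  | succ n =>
    -- `x + d (sepHom x)` is a cycle in `sepSpan`, where `-sepHom` recovers elements from their
    -- boundaries
    have hz := add_compHom_sepHom_mem x
    have h := sepHom_compHom_diff hz
    rw [map_add, LinearMap.add_apply, hx, compHom_assoc, diff_diff, map_zero, add_zero, map_zero,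
      eq_comm, neg_eq_zero] at h
    refine ⟨-sepHom k n (m + 1) x, ?_⟩
    rw [map_neg, LinearMap.neg_apply]
    exact (eq_neg_of_add_eq_zero_left h).symm

end

end

end LieSh

open LieSh CategoryTheory in
theorem mainTheorem2 (k : Type*) [CommRing k] (n i : ℕ) (hi : 0 < i) :
    CategoryTheory.Limits.IsZero (LieSh.leibnizHomology (LieSh.projGen k n) i) := by
  obtain ⟨m, rfl⟩ := Nat.exists_eq_add_of_lt hi
  rw [zero_add]
  unfold leibnizHomology
  rw [← HomologicalComplex.exactAt_iff_isZero_homology,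
    HomologicalComplex.exactAt_iff' _ (m + 2) (m + 1) m (by simp) (by simp),
    ShortComplex.moduleCat_exact_iff]
  have hd : ∀ j, (leibnizComplex (projGen k n)).d (j + 1) j = (projGen k n).map (diffMor k j) :=
    ChainComplex.of_d (fun j => (projGen k n).obj (GammaShLie.obj j))
      fun j => (projGen k n).map (diffMor k j)
  intro x hx
  change ((leibnizComplex (projGen k n)).d (m + 1) m) x = 0 at hx
  rw [hd] at hx
  obtain ⟨y, hy⟩ := exists_compHom_diff_eq n x hx
  refine ⟨y, ?_⟩
  change ((leibnizComplex (projGen k n)).d (m + 1 + 1) (m + 1)) y = x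
  rw [hd]
  exact hy
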